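/- Let $a_+,a_->0$, put $a=(a_++a_-)/2$, and let $\rho\in\mathbb{C}$. Let $G(z)=G(a_+,a_-;z)$ be the hyperbolic gamma function, i.e. the meromorphic function on $\mathbb{C}$ that for $|\mathrm{Im}\,z|<a$ is given by $$G(z)=\exp\Big(i\int_0^\infty\frac{dy}{y}\Big(\frac{\sin 2yz}{2\sinh(a_+y)\sinh(a_-y)}-\frac{z}{a_+a_-y}\Big)\Big)$$ and that satisfies $G(z+ia_\delta/2)=2\cosh(\pi z/a_{-\delta})\,G(z-ia_\delta/2)$ for $\delta=+,-$. (Its zeros are the points $i(a+ka_++la_-)$ and its poles the points $-i(a+ka_++la_-)$, $k,l=0,1,2,\dots$.) For $\delta\in\{+,-\}$ put $s_\delta(z)=\sinh(\pi z/a_\delta)$ and $e_\delta(z)=\exp(\pi z/a_\delta)$. For $M\ge 0$, $k\ge 0$ and $\tau\in\{+,-\}$ let $A_{\tau k,\delta}(x_1,\dots,x_M)$ be the analytic difference operator $$A_{\tau k,\delta}(x_1,\dots,x_M)=\sum_{\substack{I\subset\{1,\dots,M\}\\|I|=k}}\ \prod_{\substack{m\in I\\ n\notin I}}\frac{s_\delta(x_m-x_n-\tau\rho)}{s_\delta(x_m-x_n)}\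 \prod_{m\in I}\exp(-\tau i a_{-\delta}\partial_{x_m}),$$ where $\exp(c\,\partial_{x_m})$ is the shift $x_m\mapsto x_m+c$; thus $A_{0,\delta}=1$, and $A_{\tau k,\delta}=0$ for $k>M$. For $N\ge 1$ and $\ell=0,1,\dots,N$ let $$\mathcal{S}_\ell(x,y)=\prod_{m=1}^N\prod_{n=1}^{N-\ell}\frac{G(x_m-y_n-\rho/2)}{G(x_m-y_n+\rho/2)},\qquad \mathcal{S}_N\equiv 1,$$ and let $c^\delta_{\ell,j}$, $j=0,\dots,\ell$, be the $j$th elementary symmetric function of the $\ell$ numbers $e_\delta((\ell-1)\rho),e_\delta((\ell-3)\rho),\dots,e_\delta(-(\ell-1)\rho)$ (so $c^\delta_{\ell,0}=1$). **Theorem.** For all $\ell\in\{0,\dots,N\}$, $k\in\{1,\dots,N\}$ and $\tau,\delta\in\{+,-\}$, $$A_{\tau k,\delta}(x_1,\dots,x_N)\,\mathcal{S}_\ell(x,y)=\sum_{j=0}^{\min(k,\ell)}c^\delta_{\ell,j}\,A_{-\tau(k-j),\delta}(y_1,\dots,y_{N-\ell})\,\mathcal{S}_\ell(x,y)$$ as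 an identity between meromorphic functions of $(x,y)\in\mathbb{C}^N\times\mathbb{C}^{N-\ell}$. More precisely, it holds at every point $(x,y)$ at which all coefficients $s_\delta(\cdot)^{-1}$ of the operators are finite and, for $z=x_m-y_n$ and for $z=x_m-y_n-\tau ia_{-\delta}$ (all $m,n$), $G(z-\rho/2)$ is finite and $G(z+\rho/2)$ is nonzero. In particular, at all such points: 1. ($k=1$) if $s_\delta(\rho)\neq 0$, then $\big(A_{\tau 1,\delta}(x_1,\dots,x_N)-A_{-\tau 1,\delta}(y_1,\dots,y_{N-\ell})\big)\mathcal{S}_\ell(x,y)=\dfrac{s_\delta(\ell\rho)}{s_\delta(\rho)}\,\mathcal{S}_\ell(x,y)$ for $\ell=0,\dots,N$; 2. ($\ell=1$) $A_{\tau k,\delta}(x_1,\dots,x_N)\mathcal{S}_1(x,y)=\big(A_{-\tau k,\delta}(y_1,\dots,y_{N-1})+A_{-\tau(k-1),\delta}(y_1,\dots,y_{N-1})\big)\mathcal{S}_1(x,y)$ for $k=1,\dots,N$; 3. ($\ell=N$) $\displaystyle\sum_{\substack{I\subset\{1,\dots,N\}\\|I|=k}}\prod_{\substack{m\in I\\ n\notin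 I}}\frac{s_\delta(x_m-x_n-\tau\rho)}{s_\delta(x_m-x_n)}=c^\delta_{N,k}$ for $k=1,\dots,N$, whenever $s_\delta(x_m-x_n)\neq 0$ for all $m\neq n$. -/

import Mathlib

open scoped BigOperators

noncomputable section

namespace HyperbolicRCM

/-- The pair of length scales `a_+ = ap`, `a_- = am`, indexed by a sign `δ ∈ {+1, -1} = ℤˣ`. -/
def scale (ap am : ℝ) (δ : ℤˣ) : ℝ := if δ = 1 then ap else am

/-- `s_δ(z) = sinh(π z / a_δ)`. -/
def s (ap am : ℝ) (δ : ℤˣ) (z : ℂ) : ℂ :=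
  Complex.sinh (Real.pi * z / (scale ap am δ : ℂ))

/-- `e_δ(z) = exp(π z / a_δ)`. -/
def e (ap am : ℝ) (δ : ℤˣ) (z : ℂ) : ℂ :=
  Complex.exp (Real.pi * z / (scale ap am δ : ℂ))

/-- The function `g(a_+, a_-; z)`, given for `|Im z| < (a_+ + a_-)/2` by the (absolutely convergent)
integral `∫_0^∞ (sin(2yz) / (2 sinh(a_+ y) sinh(a_- y)) - z / (a_+ a_- y)) dy / y`. -/
def g (ap am : ℝ) (z : ℂ) : ℂ :=
  ∫ y in Set.Ioi (0 : ℝ),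
    (1 / (y : ℂ)) *
      (Complex.sin (2 * y * z) / (2 * Complex.sinh (ap * y) * Complex.sinh (am * y))
        - z / (ap * am * y))

/-- The hyperbolic gamma function `G(a_+, a_-; z)`: it equals `exp(i g(z))` in the strip
`|Im z| < (a_+ + a_-)/2`, and is continued meromorphically to the whole plane by the difference
equation `G(z + i a_+/2) = 2 cosh(π z / a_-) G(z - i a_+/2)`.  Explicitly, with `n` the integer
nearest to `Im z / a_+`, the point `z - n i a_+` satisfies `|Im| ≤ a_+/2`, hence lies in the strip,
and the difference equation is applied `|n|` times.  (At the poles the value is `0`, by the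
convention for division by zero.) -/
def G (ap am : ℝ) (z : ℂ) : ℂ :=
  let n : ℤ := round (z.im / ap)
  Complex.exp (Complex.I * g ap am (z - n * (Complex.I * ap))) *
      (∏ j ∈ Finset.range n.toNat,
        2 * Complex.cosh (Real.pi * (z - (j + 1 / 2) * (Complex.I * ap)) / am)) /
      (∏ j ∈ Finset.range (-n).toNat,
        2 * Complex.cosh (Real.pi * (z + (j + 1 / 2) * (Complex.I * ap)) / am))

/-- The zeros `i (a + k a_+ + l a_-)`, `k, l = 0, 1, 2, …`, of the hyperbolic gamma function,
where `a = (a_+ + a_-)/2`. -/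
def zeroSet (ap am : ℝ) : Set ℂ :=
  {z | ∃ k l : ℕ, z = Complex.I * ((ap + am) / 2 + k * ap + l * am)}

/-- The poles `-i (a + k a_+ + l a_-)`, `k, l = 0, 1, 2, …`, of the hyperbolic gamma function. -/
def poleSet (ap am : ℝ) : Set ℂ := {z | -z ∈ zeroSet ap am}

/-- The analytic difference operator `A_{τ k, δ}(x_1, …, x_M)`, with
`(A_{τ k, δ} F)(x) = ∑_{|I| = k} ∏_{m ∈ I, n ∉ I} s_δ(x_m - x_n - τ ρ) / s_δ(x_m - x_n) ·
F(x - τ i a_{-δ} 1_I)`.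
For `k = 0` only `I = ∅` contributes, so this is the identity, and for `k > M` the sum is empty,
so this is the zero operator. -/
def A (ap am : ℝ) (ρ : ℂ) (δ τ : ℤˣ) {M : ℕ} (k : ℕ)
    (F : (Fin M → ℂ) → ℂ) (x : Fin M → ℂ) : ℂ :=
  ∑ I ∈ Finset.powersetCard k (Finset.univ : Finset (Fin M)),
    (∏ m ∈ I, ∏ n ∈ Iᶜ,
        s ap am δ (x m - x n - ((τ : ℤ) : ℂ) * ρ) / s ap am δ (x m - x n)) *
      F (fun m => if m ∈ I then x m - ((τ : ℤ) : ℂ) * (Complex.I * scale ap am (-δ)) else x m)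

/-- The kernel function `∏_m ∏_n G(x_m - y_n - ρ/2) / G(x_m - y_n + ρ/2)` in `N + M` variables. -/
def S (ap am : ℝ) (ρ : ℂ) {N M : ℕ} (x : Fin N → ℂ) (y : Fin M → ℂ) : ℂ :=
  ∏ m, ∏ n, G ap am (x m - y n - ρ / 2) / G ap am (x m - y n + ρ / 2)

/-- The coefficient `c^δ_{ℓ,j}`, i.e. the `j`th elementary symmetric function of the `ℓ` numbers
`e_δ((ℓ-1)ρ), e_δ((ℓ-3)ρ), …, e_δ(-(ℓ-1)ρ)`. -/
def c (ap am : ℝ) (ρ : ℂ) (δ : ℤˣ) (l j : ℕ) : ℂ :=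
  ((Multiset.range l).map fun i : ℕ => e ap am δ (((l : ℂ) - 1 - 2 * i) * ρ)).esymm j

/-- The points at which all coefficients of `A_{κ, δ}(x)` are regular:
`s_δ(x_m - x_n) ≠ 0` for `m ≠ n`. -/
def RegularPoint (ap am : ℝ) (δ : ℤˣ) {M : ℕ} (x : Fin M → ℂ) : Prop :=
  ∀ m n, m ≠ n → s ap am δ (x m - x n) ≠ 0

/-- No factor `G(z - ρ/2) / G(z + ρ/2)` has a singular numerator or a vanishing denominator, for
`z = x_m - y_n` and for the shifted argument `z = x_m - y_n - τ i a_{-δ}`.  The excluded points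
form a locally finite union of complex hyperplanes. -/
def RegularKernel (ap am : ℝ) (ρ : ℂ) (δ τ : ℤˣ) {N M : ℕ}
    (x : Fin N → ℂ) (y : Fin M → ℂ) : Prop :=
  ∀ m n, ∀ z : ℂ,
    (z = x m - y n ∨ z = x m - y n - ((τ : ℤ) : ℂ) * (Complex.I * scale ap am (-δ))) →
      z - ρ / 2 ∉ poleSet ap am ∧ z + ρ / 2 ∉ zeroSet ap am

end HyperbolicRCM

end

/-! ### Absolute convergence and continuity of the integral `g` in the strip. -/

noncomputable section

open MeasureTheory Set Filter Topology

namespace HyperbolicRCM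

/-! The gamma function enters only through its difference equation. Shifting `x m` by `-τ i a_{-δ}`
multiplies the factor of the kernel function in `x m - y n` by a quotient of two hyperbolic cosines
(`kernelFactor_shift`), and shifting `y n` by `+τ i a_{-δ}` produces the same quotient, since only
differences occur. After factoring out `S`, and after a translation of `y` that turns `cosh` into
`sinh`, the theorem is an identity between finite sums of products of `sinh` quotients,
`subsetSum_eq_sum`.

For equally many variables (`subsetSum_eq_subsetSum`) this identity comes from the Cauchy matrix
with entries `1 / sinh (x i - t j)`. Its determinant is a Vandermonde product in `x` divided by the
product of all `sinh (x i - t j)`, up to a constant depending on `t`. Hence replacing `x i` by `x i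
- ρ` in a set `I` of rows multiplies it by exactly the `I`-term of the operator. The determinant of
the Cauchy matrix plus `u` times its shifted copy, expanded by rows, is therefore the generating
function of the sums over `x`; expanded by columns it is that of the sums over `y`.

For fewer `y` variables, one of them is sent to `+∞`. Every `sinh` quotient containing it tends to
`exp (±ρ)`, and the resulting powers obey the recursion of the elementary symmetric functions `c`
(`expESymm_succ_succ`).

It remains to prove the two difference equations for `G` as defined. In the strip the difference of
two values of `g` is an integral whose derivative is evaluated by the partial fractions of the
cotangent (`integral_hIntDeriv`). The step `i a_+` is built into `G`; the step `i a_-` is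
transported from the strip (`G_add_I_mul_right`). Zeros and poles of `G` lie on the imaginary axis,
so the identity is first proved where the relevant real parts are nonzero. The other regular points
are limits of such points under a common real translation of `x` (`kernel_identity`). -/

theorem norm_cos_le_exp (w : ℂ) : ‖Complex.cos w‖ ≤ Real.exp |w.im| := by
  rw [Complex.cos, norm_div, Complex.norm_ofNat, div_le_iff₀ two_pos]
  refine (norm_add_le _ _).trans ?_
  rw [Complex.norm_exp, Complex.norm_exp]
  have h1 : (w * Complex.I).re ≤ |w.im| := by simpa using neg_le_abs w.im
  have h2 : (-w * Complex.I).re ≤ |w.im| := by simpa using le_abs_self w.im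
  have := Real.exp_le_exp.2 h1
  have := Real.exp_le_exp.2 h2
  linarith

/-- A mean value bound along the segment from `0` to `1`. -/
theorem norm_le_of_hasDerivAt_unit {f f' : ℝ → ℂ} {C : ℝ} (h0 : f 0 = 0)
    (hf : ∀ t ∈ Icc (0 : ℝ) 1, HasDerivAt f (f' t) t) (hC : ∀ t ∈ Icc (0 : ℝ) 1, ‖f' t‖ ≤ C) :
    ‖f 1‖ ≤ C := by
  have := (convex_Icc (0 : ℝ) 1).norm_image_sub_le_of_norm_hasDerivWithin_le
    (fun t ht => (hf t ht).hasDerivWithinAt) hC (left_mem_Icc.2 zero_le_one)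
    (right_mem_Icc.2 zero_le_one)
  simpa [h0] using this

theorem abs_im_real_mul_le {t : ℝ} (ht : t ∈ Icc (0 : ℝ) 1) (w : ℂ) :
    |((t : ℂ) * w).im| ≤ |w.im| := by
  rw [Complex.im_ofReal_mul, abs_mul, abs_of_nonneg ht.1]
  exact mul_le_of_le_one_left (abs_nonneg _) ht.2

theorem norm_sin_le_norm_mul_exp (w : ℂ) : ‖Complex.sin w‖ ≤ ‖w‖ * Real.exp |w.im| := by
  have := norm_le_of_hasDerivAt_unit (f := fun t : ℝ => Complex.sin (t * w))
    (f' := fun t : ℝ => Complex.cos (t * w) * w) (C := ‖w‖ * Real.exp |w.im|) (by simp)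
    (fun t _ => by
      have h : HasDerivAt (fun t : ℝ => (t : ℂ) * w) w t := by
        simpa using (Complex.ofRealCLM.hasDerivAt (x := t)).mul_const w
      exact (Complex.hasDerivAt_sin _).comp t h)
    (fun t ht => by
      rw [norm_mul, mul_comm]
      gcongr
      exact (norm_cos_le_exp _).trans (Real.exp_le_exp.2 (abs_im_real_mul_le ht w)))
  simpa using this

theorem norm_sin_sub_self_le (w : ℂ) :
    ‖Complex.sin w - w‖ ≤ ‖w‖ ^ 3 * Real.exp |w.im| := by
  have := norm_le_of_hasDerivAt_unit (f := fun t : ℝ => Complex.sin (t * w) - t * w)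
    (f' := fun t : ℝ => Complex.cos (t * w) * w - w) (C := ‖w‖ ^ 3 * Real.exp |w.im|) (by simp)
    (fun t _ => by
      have h : HasDerivAt (fun t : ℝ => (t : ℂ) * w) w t := by
        simpa using (Complex.ofRealCLM.hasDerivAt (x := t)).mul_const w
      exact ((Complex.hasDerivAt_sin _).comp t h).sub h)
    (fun t ht => by
      -- The half-angle formula writes the derivative through a squared sine; each factor costs only
      -- `exp (|Im w| / 2)`, so no exponential growth is lost.
      have h1 : Complex.cos (t * w) * w - w = -2 * Complex.sin (t / 2 * w) ^ 2 * w := by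
        rw [show (t : ℂ) * w = 2 * (t / 2 * w) by ring, Complex.cos_two_mul,
          Complex.cos_sq']
        ring
      have ht' : t / 2 ∈ Icc (0 : ℝ) 1 := ⟨by linarith [ht.1], by linarith [ht.2]⟩
      have h2 := norm_sin_le_norm_mul_exp (t / 2 * w)
      have h3 : ‖(t / 2 * w : ℂ)‖ ≤ ‖w‖ / 2 := by
        rw [norm_mul, norm_div, Complex.norm_real, Complex.norm_ofNat, Real.norm_of_nonneg ht.1]
        have := mul_le_of_le_one_left (norm_nonneg w) ht.2
        linarith
      have h4 : |((t / 2 * w : ℂ)).im| ≤ |w.im| / 2 := by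
        have : ((t / 2 * w : ℂ)).im = t * (w.im / 2) := by
          rw [show (t / 2 * w : ℂ) = ((t / 2 : ℝ) : ℂ) * w by push_cast; ring,
            Complex.im_ofReal_mul]
          ring
        rw [this, abs_mul, abs_of_nonneg ht.1, abs_div, abs_two]
        exact mul_le_of_le_one_left (by positivity) ht.2
      have h5 : ‖Complex.sin (t / 2 * w)‖ ≤ ‖w‖ / 2 * Real.exp (|w.im| / 2) :=
        h2.trans (by gcongr)
      rw [h1, norm_mul, norm_mul, norm_neg, Complex.norm_ofNat, norm_pow]
      calc 2 * ‖Complex.sin (t / 2 * w)‖ ^ 2 * ‖w‖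
          ≤ 2 * (‖w‖ / 2 * Real.exp (|w.im| / 2)) ^ 2 * ‖w‖ := by gcongr
        _ = ‖w‖ ^ 3 / 2 * Real.exp |w.im| := by
          rw [mul_pow, ← Real.exp_nat_mul]
          rw [show ((2 : ℕ) : ℝ) * (|w.im| / 2) = |w.im| by push_cast; ring]
          ring
        _ ≤ _ := by gcongr; linarith [pow_nonneg (norm_nonneg w) 3])
  simpa using this

/-- Equivalent to `1 + 2 y ≤ exp (2 y)`. The full decay rate of `1 / sinh` is kept, as is needed to
reach every point of the open strip. -/
theorem div_sinh_le {y : ℝ} (hy : 0 < y) : y / Real.sinh y ≤ (1 + 2 * y) * Real.exp (-y) := by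
  have hs : 0 < Real.sinh y := Real.sinh_pos_iff.2 hy
  rw [div_le_iff₀ hs, Real.sinh_eq]
  have h1 : 1 + 2 * y ≤ Real.exp (2 * y) := by linarith [Real.add_one_le_exp (2 * y)]
  have h2 : Real.exp (-y) * Real.exp y = 1 := by rw [← Real.exp_add]; simp
  have h3 : Real.exp (2 * y) * (Real.exp (-y) * Real.exp (-y)) = 1 := by
    rw [← Real.exp_add, ← Real.exp_add]; simp; ring
  have h4 := mul_le_mul_of_nonneg_right h1
    (mul_pos (Real.exp_pos (-y)) (Real.exp_pos (-y))).le
  nlinarith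

theorem inv_sub_inv_sinh_nonneg {u : ℝ} (hu : 0 < u) : 0 ≤ 1 / u - 1 / Real.sinh u :=
  sub_nonneg.2 (one_div_le_one_div_of_le hu (Real.self_le_sinh_iff.2 hu.le))

theorem inv_sub_inv_sinh_le {u : ℝ} (hu : 0 < u) :
    1 / u - 1 / Real.sinh u ≤ u * (1 + 2 * u) := by
  have hs : 0 < Real.sinh u := Real.sinh_pos_iff.2 hu
  have h1 : Real.sinh u - u ≤ u ^ 3 * Real.exp u := by
    -- The cubic sine bound on the imaginary axis is a bound for `sinh u - u`.
    have h := norm_sin_sub_self_le ((u : ℂ) * Complex.I)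
    rw [Complex.sin_mul_I, ← sub_mul, norm_mul, norm_mul, Complex.norm_I, ← Complex.ofReal_sinh,
      ← Complex.ofReal_sub, Complex.norm_real, Complex.norm_real, Real.norm_of_nonneg hu.le] at h
    simp only [mul_one, Complex.im_ofReal_mul, Complex.I_im, abs_of_pos hu] at h
    exact (le_abs_self _).trans h
  have h2 := div_sinh_le hu
  calc 1 / u - 1 / Real.sinh u = (Real.sinh u - u) / (u * Real.sinh u) := by field_simp
    _ ≤ u ^ 3 * Real.exp u / (u * Real.sinh u) := by gcongr
    _ = u * Real.exp u * (u / Real.sinh u) := by field_simp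
    _ ≤ u * Real.exp u * ((1 + 2 * u) * Real.exp (-u)) := by gcongr
    _ = u * (1 + 2 * u) * (Real.exp u * Real.exp (-u)) := by ring
    _ = _ := by rw [← Real.exp_add]; simp

/-- The regular part of the integrand of `g`. -/
def gReg (ap am : ℝ) (z : ℂ) (y : ℝ) : ℂ :=
  (Complex.sin (2 * y * z) - 2 * y * z) /
    (2 * y * Complex.sinh (ap * y) * Complex.sinh (am * y))

/-- The coefficient of `z` in the remaining part of the integrand of `g`. -/
def gLin (ap am : ℝ) (y : ℝ) : ℝ :=
  1 / (Real.sinh (ap * y) * Real.sinh (am * y)) - 1 / (ap * y * (am * y))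

/-- The integrand of `g`. -/
def gInt (ap am : ℝ) (z : ℂ) (y : ℝ) : ℂ :=
  (1 / (y : ℂ)) *
    (Complex.sin (2 * y * z) / (2 * Complex.sinh (ap * y) * Complex.sinh (am * y))
      - z / (ap * am * y))

theorem g_eq_integral (ap am : ℝ) (z : ℂ) : g ap am z = ∫ y in Ioi (0 : ℝ), gInt ap am z y := rfl

theorem sinh_ofReal_mul_ne_zero {a y : ℝ} (ha : 0 < a) (hy : 0 < y) :
    Complex.sinh (a * y) ≠ 0 := by
  rw [← Complex.ofReal_mul, ← Complex.ofReal_sinh]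
  exact_mod_cast (Real.sinh_pos_iff.2 (mul_pos ha hy)).ne'

theorem gInt_eq {ap am : ℝ} (hap : 0 < ap) (ham : 0 < am) (z : ℂ) {y : ℝ} (hy : 0 < y) :
    gInt ap am z y = gReg ap am z y + z * gLin ap am y := by
  have h1 := sinh_ofReal_mul_ne_zero hap hy
  have h2 := sinh_ofReal_mul_ne_zero ham hy
  have h3 : (y : ℂ) ≠ 0 := by exact_mod_cast hy.ne'
  have h4 : (ap : ℂ) ≠ 0 := by exact_mod_cast hap.ne'
  have h5 : (am : ℂ) ≠ 0 := by exact_mod_cast ham.ne'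
  simp only [gInt, gReg, gLin]
  push_cast
  field_simp
  ring

/-- Uniform for `‖z‖ ≤ R` and `|Im z| ≤ β`, so that it also serves as a dominating function. The two
`sinh` decay like `exp (-(ap + am) y)` against the growth `exp (2 β y)` of the sine; this fixes the
width of the strip. -/
theorem norm_gReg_le {ap am : ℝ} (hap : 0 < ap) (ham : 0 < am) {R β : ℝ} {z : ℂ} (hR : ‖z‖ ≤ R)
    (hβ : |z.im| ≤ β) {y : ℝ} (hy : 0 < y) :
    ‖gReg ap am z y‖ ≤ 4 * R ^ 3 / (ap * am) *
      ((1 + 2 * (ap * y)) * (1 + 2 * (am * y)) * Real.exp (-(ap + am - 2 * β) * y)) := by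
  have hs1 : 0 < Real.sinh (ap * y) := Real.sinh_pos_iff.2 (mul_pos hap hy)
  have hs2 : 0 < Real.sinh (am * y) := Real.sinh_pos_iff.2 (mul_pos ham hy)
  have hR0 : 0 ≤ R := (norm_nonneg z).trans hR
  have h0 := norm_sin_sub_self_le (2 * y * z)
  have hn : ‖(2 * y * z : ℂ)‖ = 2 * y * ‖z‖ := by
    rw [norm_mul, norm_mul, Complex.norm_ofNat, Complex.norm_real, Real.norm_of_nonneg hy.le]
  have hi : |(2 * y * z : ℂ).im| = 2 * y * |z.im| := by
    rw [show (2 * y * z : ℂ) = ((2 * y : ℝ) : ℂ) * z by push_cast; ring, Complex.im_ofReal_mul,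
      abs_mul, abs_of_pos (by positivity)]
  rw [hn, hi] at h0
  have h1 : ‖gReg ap am z y‖ = ‖Complex.sin (2 * y * z) - 2 * y * z‖ /
      (2 * y * Real.sinh (ap * y) * Real.sinh (am * y)) := by
    rw [gReg, norm_div]
    congr 1
    rw [← Complex.ofReal_mul, ← Complex.ofReal_mul, ← Complex.ofReal_sinh, ← Complex.ofReal_sinh,
      show (2 * y * (Real.sinh (ap * y) : ℝ) * (Real.sinh (am * y) : ℝ) : ℂ) =
        ((2 * y * Real.sinh (ap * y) * Real.sinh (am * y) : ℝ) : ℂ) by push_cast; rfl,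
      Complex.norm_real, Real.norm_of_nonneg (by positivity)]
  have h2 := div_sinh_le (mul_pos hap hy)
  have h3 := div_sinh_le (mul_pos ham hy)
  rw [h1]
  calc _ ≤ (2 * y * R) ^ 3 * Real.exp (2 * y * β) /
        (2 * y * Real.sinh (ap * y) * Real.sinh (am * y)) := by
        gcongr
        exact h0.trans (by gcongr)
    _ = 4 * R ^ 3 / (ap * am) * Real.exp (2 * y * β) *
        ((ap * y / Real.sinh (ap * y)) * (am * y / Real.sinh (am * y))) := by
        field_simp
        ring
    _ ≤ 4 * R ^ 3 / (ap * am) * Real.exp (2 * y * β) *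
        (((1 + 2 * (ap * y)) * Real.exp (-(ap * y))) *
          ((1 + 2 * (am * y)) * Real.exp (-(am * y)))) := by
        gcongr
    _ = 4 * R ^ 3 / (ap * am) * ((1 + 2 * (ap * y)) * (1 + 2 * (am * y)) *
        (Real.exp (2 * y * β) * Real.exp (-(ap * y)) * Real.exp (-(am * y)))) := by ring
    _ = _ := by
        rw [← Real.exp_add, ← Real.exp_add]
        congr 4
        ring

theorem integrableOn_pow_mul_exp_neg (n : ℕ) {c : ℝ} (hc : 0 < c) :
    IntegrableOn (fun y : ℝ => y ^ n * Real.exp (-c * y)) (Ioi 0) := by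
  refine integrable_of_isBigO_exp_neg (b := c / 2) (half_pos hc) (by fun_prop) ?_
  have h := (isLittleO_pow_exp_pos_mul_atTop n (half_pos hc)).isBigO.mul
    (Asymptotics.isBigO_refl (fun y : ℝ => Real.exp (-c * y)) atTop)
  refine h.trans_eventuallyEq (Eventually.of_forall fun y => ?_)
  simp only [← Real.exp_add]
  congr 1
  ring

theorem integrableOn_gReg_bound (ap am : ℝ) {c : ℝ} (hc : 0 < c) (K : ℝ) :
    IntegrableOn (fun y : ℝ => K *
      ((1 + 2 * (ap * y)) * (1 + 2 * (am * y)) * Real.exp (-c * y))) (Ioi 0) := by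
  have h := (((integrableOn_pow_mul_exp_neg 0 hc).add
    ((integrableOn_pow_mul_exp_neg 1 hc).const_mul (2 * ap + 2 * am))).add
    ((integrableOn_pow_mul_exp_neg 2 hc).const_mul (4 * ap * am))).const_mul K
  refine h.congr (Eventually.of_forall fun y => ?_)
  simp only [Pi.add_apply]
  ring

theorem gLin_nonpos {ap am : ℝ} (hap : 0 < ap) (ham : 0 < am) {y : ℝ} (hy : 0 < y) :
    gLin ap am y ≤ 0 := by
  have h1 := mul_pos hap hy
  have h2 := mul_pos ham hy
  exact sub_nonpos.2 (one_div_le_one_div_of_le (by positivity)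
    (mul_le_mul (Real.self_le_sinh_iff.2 h1.le) (Real.self_le_sinh_iff.2 h2.le) h2.le
      (Real.sinh_pos_iff.2 h1).le))

theorem norm_gLin_le_inv {ap am : ℝ} (hap : 0 < ap) (ham : 0 < am) {y : ℝ} (hy : 0 < y) :
    ‖gLin ap am y‖ ≤ 1 / (ap * am) * y ^ (-2 : ℝ) := by
  have hs1 : 0 < Real.sinh (ap * y) := Real.sinh_pos_iff.2 (mul_pos hap hy)
  have hs2 : 0 < Real.sinh (am * y) := Real.sinh_pos_iff.2 (mul_pos ham hy)
  rw [Real.norm_of_nonpos (gLin_nonpos hap ham hy), gLin, neg_sub, Real.rpow_neg hy.le,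
    Real.rpow_two]
  have : 0 < 1 / (Real.sinh (ap * y) * Real.sinh (am * y)) := by positivity
  have h : 1 / (ap * y * (am * y)) = 1 / (ap * am) * (y ^ 2)⁻¹ := by field_simp
  linarith

/-- Replacing one `sinh` at a time by its argument leaves two terms, both bounded near `0`. The `y ^
(-2)` bound of `norm_gLin_le_inv` covers infinity. -/
theorem norm_gLin_le {ap am : ℝ} (hap : 0 < ap) (ham : 0 < am) {y : ℝ} (hy : 0 < y) :
    ‖gLin ap am y‖ ≤ am / ap * (1 + 2 * (am * y)) + ap / am * (1 + 2 * (ap * y)) := by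
  have h1 := mul_pos hap hy
  have h2 := mul_pos ham hy
  have hs1 : 0 < Real.sinh (ap * y) := Real.sinh_pos_iff.2 h1
  have hs2 : 0 < Real.sinh (am * y) := Real.sinh_pos_iff.2 h2
  rw [Real.norm_of_nonpos (gLin_nonpos hap ham hy), gLin, neg_sub]
  calc _ = 1 / (ap * y) * (1 / (am * y) - 1 / Real.sinh (am * y)) +
        1 / Real.sinh (am * y) * (1 / (ap * y) - 1 / Real.sinh (ap * y)) := by
        field_simp
        ring
    _ ≤ 1 / (ap * y) * (am * y * (1 + 2 * (am * y))) +
        1 / (am * y) * (ap * y * (1 + 2 * (ap * y))) := by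
        have h3 := inv_sub_inv_sinh_nonneg h1
        have h4 := inv_sub_inv_sinh_le h1
        have h5 := inv_sub_inv_sinh_le h2
        have h6 := Real.self_le_sinh_iff.2 h2.le
        gcongr
    _ = _ := by field_simp

theorem integrableOn_gLin {ap am : ℝ} (hap : 0 < ap) (ham : 0 < am) :
    IntegrableOn (gLin ap am) (Ioi 0) := by
  have hm : Measurable (gLin ap am) := by
    unfold gLin
    fun_prop
  rw [← Ioc_union_Ioi_eq_Ioi zero_le_one]
  refine IntegrableOn.union ?_ ?_
  · have hb : IntegrableOn (fun y : ℝ => am / ap * (1 + 2 * (am * y)) +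
        ap / am * (1 + 2 * (ap * y))) (Ioc 0 1) :=
      (Continuous.integrableOn_Icc (by fun_prop)).mono_set Ioc_subset_Icc_self
    exact hb.mono' hm.aestronglyMeasurable
      ((ae_restrict_iff' measurableSet_Ioc).2 (Eventually.of_forall fun y hy =>
        norm_gLin_le hap ham hy.1))
  · have hb : IntegrableOn (fun y : ℝ => 1 / (ap * am) * y ^ (-2 : ℝ)) (Ioi 1) :=
      (integrableOn_Ioi_rpow_of_lt (by norm_num) zero_lt_one).const_mul _
    exact hb.mono' hm.aestronglyMeasurable
      ((ae_restrict_iff' measurableSet_Ioi).2 (Eventually.of_forall fun y hy =>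
        norm_gLin_le_inv hap ham (zero_lt_one.trans hy)))

theorem integrableOn_ofReal_gLin {ap am : ℝ} (hap : 0 < ap) (ham : 0 < am) :
    IntegrableOn (fun y => (gLin ap am y : ℂ)) (Ioi 0) :=
  (integrableOn_gLin hap ham).ofReal

theorem measurable_gReg (ap am : ℝ) (z : ℂ) : Measurable (gReg ap am z) := by
  unfold gReg
  fun_prop

theorem integrableOn_gReg {ap am : ℝ} (hap : 0 < ap) (ham : 0 < am) {z : ℂ}
    (hz : |z.im| < (ap + am) / 2) : IntegrableOn (gReg ap am z) (Ioi 0) :=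
  (integrableOn_gReg_bound ap am (c := ap + am - 2 * |z.im|) (by linarith) _).mono'
    (measurable_gReg ap am z).aestronglyMeasurable
    ((ae_restrict_iff' measurableSet_Ioi).2 (Eventually.of_forall fun _ hy =>
      norm_gReg_le hap ham le_rfl le_rfl hy))

theorem integrableOn_gInt {ap am : ℝ} (hap : 0 < ap) (ham : 0 < am) {z : ℂ}
    (hz : |z.im| < (ap + am) / 2) : IntegrableOn (gInt ap am z) (Ioi 0) := by
  refine ((integrableOn_gReg hap ham hz).add ((integrableOn_ofReal_gLin hap ham).const_mul z)).congr
    ((ae_restrict_iff' measurableSet_Ioi).2 (Eventually.of_forall fun y hy => ?_))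
  exact (gInt_eq hap ham z hy).symm

theorem continuousAt_g {ap am : ℝ} (hap : 0 < ap) (ham : 0 < am) {z : ℂ}
    (hz : |z.im| < (ap + am) / 2) : ContinuousAt (g ap am) z := by
  -- The midpoint between `|Im z|` and the half-width of the strip leaves a positive decay rate,
  -- uniform near `z`.
  have hstrip : ∀ᶠ w : ℂ in 𝓝 z, |w.im| < (|z.im| + (ap + am) / 2) / 2 :=
    (Complex.continuous_im.abs.continuousAt).eventually_lt_const (by linarith)
  have hnorm : ∀ᶠ w : ℂ in 𝓝 z, ‖w‖ < ‖z‖ + 1 :=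
    continuous_norm.continuousAt.eventually_lt_const (by linarith)
  have hg : g ap am =ᶠ[𝓝 z] fun w =>
      (∫ y in Ioi (0 : ℝ), gReg ap am w y) + w * ∫ y in Ioi (0 : ℝ), (gLin ap am y : ℂ) := by
    filter_upwards [hstrip] with w hw
    rw [← integral_const_mul, ← integral_add (integrableOn_gReg hap ham (z := w) (by linarith))
      ((integrableOn_ofReal_gLin hap ham).const_mul w)]
    exact setIntegral_congr_fun measurableSet_Ioi fun y hy => gInt_eq hap ham w hy
  refine ContinuousAt.congr ?_ hg.symm
  refine ContinuousAt.add ?_ (continuousAt_id.mul continuousAt_const)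
  refine continuousAt_of_dominated (bound := fun y => _)
    (Eventually.of_forall fun w => (measurable_gReg ap am w).aestronglyMeasurable) ?_
    (integrableOn_gReg_bound ap am
      (c := ap + am - 2 * ((|z.im| + (ap + am) / 2) / 2)) (by linarith)
      (4 * (‖z‖ + 1) ^ 3 / (ap * am))) ?_
  · filter_upwards [hstrip, hnorm] with w hw hw'
    exact (ae_restrict_iff' measurableSet_Ioi).2 (Eventually.of_forall fun y hy =>
      norm_gReg_le hap ham hw'.le hw.le hy)
  · refine Eventually.of_forall fun y => ?_
    unfold gReg
    fun_prop

end HyperbolicRCM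

end

/-! ### The difference equation for `exp (i g)` inside the strip. -/

noncomputable section

open MeasureTheory Set Filter Topology

namespace HyperbolicRCM

theorem cosh_eq_zero {w : ℂ} (h : Complex.cosh w = 0) :
    ∃ k : ℤ, w = (k + 1 / 2) * Real.pi * Complex.I := by
  rw [← Complex.cos_mul_I, Complex.cos_eq_zero_iff] at h
  obtain ⟨k, hk⟩ := h
  refine ⟨-k - 1, ?_⟩
  have : w = -(w * Complex.I) * Complex.I := by
    linear_combination w * Complex.I_mul_I
  rw [this, hk]
  push_cast
  ring

theorem cosh_pi_mul_ne_zero {z : ℂ} (hz : |z.im| < 1 / 2) : Complex.cosh (Real.pi * z) ≠ 0 := by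
  intro h
  obtain ⟨k, hk⟩ := cosh_eq_zero h
  have hpi : (Real.pi : ℂ) ≠ 0 := by exact_mod_cast Real.pi_ne_zero
  have hz' : z = (((k : ℝ) + 1 / 2 : ℝ) : ℂ) * Complex.I := by
    apply mul_left_cancel₀ hpi
    rw [hk]
    push_cast
    ring
  rw [hz', Complex.im_ofReal_mul, Complex.I_im, mul_one, abs_lt] at hz
  have h1 : (-1 : ℝ) < k := by linarith [hz.1]
  have h2 : (k : ℝ) < 0 := by linarith [hz.2]
  have h1' : -1 < k := by exact_mod_cast h1
  have h2' : k < 0 := by exact_mod_cast h2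
  omega

/-- The integrand of the logarithm of `1 / (2 cosh (π z))`. -/
def hInt (z : ℂ) (y : ℝ) : ℂ := (Complex.cos (2 * y * z) / Complex.sinh y - 1 / y) / y

/-- The logarithm of `1 / (2 cosh (π z))`, for `|Im z| < 1 / 2`. -/
def logInvCosh (z : ℂ) : ℂ := ∫ y in Ioi (0 : ℝ), hInt z y

/-- The difference of the two sines contains the factor `sinh (b y)`, which cancels. What is left
involves `a` alone and is reduced to scale `1` by `y ↦ a y`. -/
theorem gInt_sub_gInt {a b : ℝ} (ha : 0 < a) (hb : 0 < b) (z : ℂ) {y : ℝ} (hy : 0 < y) :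
    gInt a b (z + Complex.I * b / 2) y - gInt a b (z - Complex.I * b / 2) y =
      Complex.I * (a * hInt (z / a) (a * y)) := by
  have h1 := sinh_ofReal_mul_ne_zero ha hy
  have h2 := sinh_ofReal_mul_ne_zero hb hy
  have h3 : (y : ℂ) ≠ 0 := by exact_mod_cast hy.ne'
  have h4 : (a : ℂ) ≠ 0 := by exact_mod_cast ha.ne'
  have h5 : (b : ℂ) ≠ 0 := by exact_mod_cast hb.ne'
  have h6 : Complex.sin (2 * y * (z + Complex.I * b / 2)) -
      Complex.sin (2 * y * (z - Complex.I * b / 2)) =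
      2 * Complex.I * Complex.cos (2 * y * z) * Complex.sinh (b * y) := by
    rw [show (2 * y * (z + Complex.I * b / 2) : ℂ) = 2 * y * z + b * y * Complex.I by ring,
      show (2 * y * (z - Complex.I * b / 2) : ℂ) = 2 * y * z - b * y * Complex.I by ring,
      Complex.sin_add, Complex.sin_sub, Complex.sin_mul_I]
    ring
  have h7 : (2 * (a * y : ℝ) * (z / a) : ℂ) = 2 * y * z := by
    push_cast
    field_simp
  rw [hInt, h7, gInt, gInt]
  push_cast
  calc _ = 1 / (y : ℂ) * ((Complex.sin (2 * y * (z + Complex.I * b / 2)) -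
        Complex.sin (2 * y * (z - Complex.I * b / 2))) /
        (2 * Complex.sinh (a * y) * Complex.sinh (b * y)) - Complex.I * b / (a * b * y)) := by
        ring
    _ = _ := by
        rw [h6]
        generalize Complex.sinh (a * y) = A at *
        generalize Complex.sinh (b * y) = B at *
        field_simp

theorem abs_im_add_lt {a b : ℝ} {z : ℂ} (hb : 0 < b) (hz : |z.im| < a / 2) :
    |(z + Complex.I * b / 2).im| < (a + b) / 2 ∧ |(z - Complex.I * b / 2).im| < (a + b) / 2 := by
  have h : (Complex.I * b / 2 : ℂ).im = b / 2 := by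
    rw [show (Complex.I * b / 2 : ℂ) = ((b / 2 : ℝ) : ℂ) * Complex.I by push_cast; ring,
      Complex.im_ofReal_mul, Complex.I_im, mul_one]
  rw [abs_lt] at hz
  rw [Complex.add_im, Complex.sub_im, h, abs_lt, abs_lt]
  constructor <;> constructor <;> linarith

theorem integrableOn_hInt {z : ℂ} (hz : |z.im| < 1 / 2) : IntegrableOn (hInt z) (Ioi 0) := by
  have h := abs_im_add_lt one_pos hz
  have h1 := ((integrableOn_gInt one_pos one_pos h.1).sub
    (integrableOn_gInt one_pos one_pos h.2)).const_mul (-Complex.I)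
  refine h1.congr ((ae_restrict_iff' measurableSet_Ioi).2 (Eventually.of_forall fun y hy => ?_))
  simp only [Pi.sub_apply]
  rw [gInt_sub_gInt one_pos one_pos z hy]
  simp [← mul_assoc]

theorem g_sub_g {a b : ℝ} (ha : 0 < a) (hb : 0 < b) {z : ℂ} (hz : |z.im| < a / 2) :
    g a b (z + Complex.I * b / 2) - g a b (z - Complex.I * b / 2) =
      Complex.I * logInvCosh (z / a) := by
  have h := abs_im_add_lt hb hz
  rw [g_eq_integral, g_eq_integral, ← integral_sub (integrableOn_gInt ha hb h.1)
    (integrableOn_gInt ha hb h.2),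
    setIntegral_congr_fun measurableSet_Ioi fun y hy => gInt_sub_gInt ha hb z hy,
    integral_const_mul, integral_const_mul, integral_comp_mul_left_Ioi (hInt (z / a)) 0 ha,
    mul_zero, logInvCosh, Complex.real_smul, Complex.ofReal_inv, mul_inv_cancel_left₀]
  exact_mod_cast ha.ne'

/-- The integrand of the derivative of `logInvCosh`. -/
def hIntDeriv (z : ℂ) (y : ℝ) : ℂ := -2 * Complex.sin (2 * y * z) / Complex.sinh y

theorem measurable_hIntDeriv (z : ℂ) : Measurable (hIntDeriv z) := by
  unfold hIntDeriv
  fun_prop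

theorem norm_hIntDeriv_le {R β : ℝ} {z : ℂ} (hR : ‖z‖ ≤ R) (hβ : |z.im| ≤ β) {y : ℝ}
    (hy : 0 < y) :
    ‖hIntDeriv z y‖ ≤ 4 * R * ((1 + 2 * y) * Real.exp (-(1 - 2 * β) * y)) := by
  have hs : 0 < Real.sinh y := Real.sinh_pos_iff.2 hy
  have hR0 : 0 ≤ R := (norm_nonneg z).trans hR
  have h0 := norm_sin_le_norm_mul_exp (2 * y * z)
  have hn : ‖(2 * y * z : ℂ)‖ = 2 * y * ‖z‖ := by
    rw [norm_mul, norm_mul, Complex.norm_ofNat, Complex.norm_real, Real.norm_of_nonneg hy.le]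
  have hi : |(2 * y * z : ℂ).im| = 2 * y * |z.im| := by
    rw [show (2 * y * z : ℂ) = ((2 * y : ℝ) : ℂ) * z by push_cast; ring, Complex.im_ofReal_mul,
      abs_mul, abs_of_pos (by positivity)]
  rw [hn, hi] at h0
  have h1 : ‖hIntDeriv z y‖ = 2 * ‖Complex.sin (2 * y * z)‖ / Real.sinh y := by
    rw [hIntDeriv, norm_div, norm_mul, norm_neg, Complex.norm_ofNat, ← Complex.ofReal_sinh,
      Complex.norm_real, Real.norm_of_nonneg hs.le]
  rw [h1]
  calc _ ≤ 2 * (2 * y * R * Real.exp (2 * y * β)) / Real.sinh y := by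
        gcongr
        exact h0.trans (by gcongr)
    _ = 4 * R * Real.exp (2 * y * β) * (y / Real.sinh y) := by ring
    _ ≤ 4 * R * Real.exp (2 * y * β) * ((1 + 2 * y) * Real.exp (-y)) := by
        gcongr
        exact div_sinh_le hy
    _ = 4 * R * ((1 + 2 * y) * (Real.exp (2 * y * β) * Real.exp (-y))) := by ring
    _ = _ := by
        rw [← Real.exp_add]
        congr 4
        ring

theorem integrableOn_hIntDeriv_bound {c : ℝ} (hc : 0 < c) (K : ℝ) :
    IntegrableOn (fun y : ℝ => K * ((1 + 2 * y) * Real.exp (-c * y))) (Ioi 0) := by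
  have h := ((integrableOn_pow_mul_exp_neg 0 hc).add
    ((integrableOn_pow_mul_exp_neg 1 hc).const_mul 2)).const_mul K
  refine h.congr (Eventually.of_forall fun y => ?_)
  simp only [Pi.add_apply]
  ring

theorem hasDerivAt_hInt (z : ℂ) {y : ℝ} (hy : 0 < y) :
    HasDerivAt (fun w => hInt w y) (hIntDeriv z y) z := by
  have h3 : (y : ℂ) ≠ 0 := by exact_mod_cast hy.ne'
  have h : HasDerivAt (fun w : ℂ => 2 * (y : ℂ) * w) (2 * y) z := by
    simpa using (hasDerivAt_id z).const_mul (2 * (y : ℂ))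
  have h' := ((h.ccos.div_const (Complex.sinh y)).sub_const (1 / (y : ℂ))).div_const (y : ℂ)
  refine h'.congr_deriv ?_
  rw [hIntDeriv]
  field_simp

theorem hasDerivAt_logInvCosh {z : ℂ} (hz : |z.im| < 1 / 2) :
    HasDerivAt logInvCosh (∫ y in Ioi (0 : ℝ), hIntDeriv z y) z := by
  have hstrip : ∀ᶠ w : ℂ in 𝓝 z, |w.im| < (|z.im| + 1 / 2) / 2 :=
    (Complex.continuous_im.abs.continuousAt).eventually_lt_const (by linarith)
  have hnorm : ∀ᶠ w : ℂ in 𝓝 z, ‖w‖ < ‖z‖ + 1 :=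
    continuous_norm.continuousAt.eventually_lt_const (by linarith)
  refine (hasDerivAt_integral_of_dominated_loc_of_deriv_le (F := hInt) (F' := hIntDeriv)
    (hstrip.and hnorm) (Eventually.of_forall fun w => ?_) (integrableOn_hInt hz)
    (measurable_hIntDeriv z).aestronglyMeasurable
    ((ae_restrict_iff' measurableSet_Ioi).2 (Eventually.of_forall fun y hy w hw =>
      norm_hIntDeriv_le hw.2.le hw.1.le hy))
    (integrableOn_hIntDeriv_bound (by linarith) _)
    ((ae_restrict_iff' measurableSet_Ioi).2 (Eventually.of_forall fun y hy w _ =>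
      hasDerivAt_hInt w hy))).2
  have : Measurable (hInt w) := by
    unfold hInt
    fun_prop
  exact this.aestronglyMeasurable

theorem integrableOn_hIntDeriv {z : ℂ} (hz : |z.im| < 1 / 2) :
    IntegrableOn (hIntDeriv z) (Ioi 0) :=
  (integrableOn_hIntDeriv_bound (c := 1 - 2 * |z.im|) (by linarith) _).mono'
    (measurable_hIntDeriv z).aestronglyMeasurable
    ((ae_restrict_iff' measurableSet_Ioi).2 (Eventually.of_forall fun _ hy =>
      norm_hIntDeriv_le le_rfl le_rfl hy))

/-- The truncated geometric series of `1 / sinh y`, in telescoping form. The factor `1 - exp (-2 K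
y)` keeps the sum finite, so that only a limit in `K` has to be exchanged with the integral. -/
theorem hIntDeriv_mul_eq_sum (z : ℂ) {y : ℝ} (hy : 0 < y) (K : ℕ) :
    hIntDeriv z y * (1 - Complex.exp (-2 * K * y)) = ∑ n ∈ Finset.range K,
      2 * Complex.I * (Complex.exp (-(2 * n + 1 - 2 * Complex.I * z) * y) -
        Complex.exp (-(2 * n + 1 + 2 * Complex.I * z) * y)) := by
  have h1 : Complex.sinh y ≠ 0 := by simpa using sinh_ofReal_mul_ne_zero one_pos hy
  have key : ∀ n : ℕ, 2 * Complex.I * (Complex.exp (-(2 * n + 1 - 2 * Complex.I * z) * y) -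
        Complex.exp (-(2 * n + 1 + 2 * Complex.I * z) * y)) =
      hIntDeriv z y * (1 - Complex.exp (-2 * (n + 1 : ℕ) * y)) -
        hIntDeriv z y * (1 - Complex.exp (-2 * n * y)) := by
    intro n
    have h2 : Complex.exp (-(2 * n + 1 - 2 * Complex.I * z) * y) =
        Complex.exp (2 * y * z * Complex.I) * Complex.exp (-(2 * n + 1) * y) := by
      rw [← Complex.exp_add]; ring_nf
    have h3 : Complex.exp (-(2 * n + 1 + 2 * Complex.I * z) * y) =
        Complex.exp (-(2 * y * z) * Complex.I) * Complex.exp (-(2 * n + 1) * y) := by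
      rw [← Complex.exp_add]; ring_nf
    have h4 : Complex.exp (-2 * n * y) = Complex.exp (-(2 * n + 1) * y) * Complex.exp y := by
      rw [← Complex.exp_add]; ring_nf
    have h5 : Complex.exp (-2 * (n + 1 : ℕ) * y) =
        Complex.exp (-(2 * n + 1) * y) * Complex.exp (-y) := by
      rw [← Complex.exp_add]; push_cast; ring_nf
    rw [← mul_sub, h2, h3, h4, h5, hIntDeriv, eq_comm, div_mul_eq_mul_div, div_eq_iff h1]
    rw [Complex.sinh, Complex.sin]
    ring
  rw [Finset.sum_congr rfl fun n _ => key n, Finset.sum_range_sub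
    (fun n : ℕ => hIntDeriv z y * (1 - Complex.exp (-2 * n * y)))]
  simp

theorem integral_hIntDeriv_mul {z : ℂ} (hz : |z.im| < 1 / 2) (K : ℕ) :
    ∫ y in Ioi (0 : ℝ), hIntDeriv z y * (1 - Complex.exp (-2 * K * y)) =
      ∑ n ∈ Finset.range K, 2 * Complex.I * (1 / (2 * n + 1 - 2 * Complex.I * z) -
        1 / (2 * n + 1 + 2 * Complex.I * z)) := by
  rw [abs_lt] at hz
  have hre1 : ∀ n : ℕ, (-(2 * n + 1 - 2 * Complex.I * z)).re < 0 := fun n => by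
    have : (0 : ℝ) ≤ n := n.cast_nonneg
    simp
    linarith
  have hre2 : ∀ n : ℕ, (-(2 * n + 1 + 2 * Complex.I * z)).re < 0 := fun n => by
    have : (0 : ℝ) ≤ n := n.cast_nonneg
    simp
    linarith
  have hint : ∀ n : ℕ, IntegrableOn (fun y : ℝ => 2 * Complex.I *
      (Complex.exp (-(2 * n + 1 - 2 * Complex.I * z) * y) -
        Complex.exp (-(2 * n + 1 + 2 * Complex.I * z) * y))) (Ioi 0) := fun n =>
    ((integrableOn_exp_mul_complex_Ioi (hre1 n) 0).sub
      (integrableOn_exp_mul_complex_Ioi (hre2 n) 0)).const_mul _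
  rw [setIntegral_congr_fun measurableSet_Ioi fun y hy => hIntDeriv_mul_eq_sum z hy K,
    integral_finsetSum _ fun n _ => hint n]
  refine Finset.sum_congr rfl fun n _ => ?_
  rw [integral_const_mul, integral_sub (integrableOn_exp_mul_complex_Ioi (hre1 n) 0)
    (integrableOn_exp_mul_complex_Ioi (hre2 n) 0), integral_exp_mul_complex_Ioi (hre1 n),
    integral_exp_mul_complex_Ioi (hre2 n)]
  simp only [Complex.ofReal_zero, mul_zero, Complex.exp_zero, neg_div_neg_eq]

theorem tendsto_integral_hIntDeriv_mul {z : ℂ} (hz : |z.im| < 1 / 2) :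
    Tendsto (fun K : ℕ => ∫ y in Ioi (0 : ℝ), hIntDeriv z y * (1 - Complex.exp (-2 * K * y)))
      atTop (𝓝 (∫ y in Ioi (0 : ℝ), hIntDeriv z y)) := by
  have hexp : ∀ (K : ℕ) (y : ℝ), Complex.exp (-2 * K * y) = ((Real.exp (-2 * y) ^ K : ℝ) : ℂ) := by
    intro K y
    rw [← Real.exp_nat_mul]
    push_cast
    ring_nf
  refine tendsto_integral_of_dominated_convergence (fun y => ‖hIntDeriv z y‖)
    (fun K => ((measurable_hIntDeriv z).mul (by fun_prop)).aestronglyMeasurable)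
    (integrableOn_hIntDeriv hz).norm (fun K => ?_) ?_
  · refine (ae_restrict_iff' measurableSet_Ioi).2 (Eventually.of_forall fun y hy => ?_)
    rw [norm_mul]
    refine mul_le_of_le_one_right (norm_nonneg _) ?_
    have hy' : (0 : ℝ) < y := hy
    have h1 : Real.exp (-2 * y) ^ K ≤ 1 :=
      pow_le_one₀ (Real.exp_pos _).le (Real.exp_le_one_iff.2 (by linarith))
    have h2 : 0 ≤ Real.exp (-2 * y) ^ K := by positivity
    rw [hexp, ← Complex.ofReal_one, ← Complex.ofReal_sub, Complex.norm_real,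
      Real.norm_of_nonneg (by linarith)]
    linarith
  · refine (ae_restrict_iff' measurableSet_Ioi).2 (Eventually.of_forall fun y hy => ?_)
    have hy' : (0 : ℝ) < y := hy
    have h := tendsto_pow_atTop_nhds_zero_of_lt_one (Real.exp_pos (-2 * y)).le
      (Real.exp_zero ▸ Real.exp_lt_exp.2 (by linarith : -2 * y < 0))
    have h' := ((Complex.continuous_ofReal.tendsto _).comp h).const_sub (1 : ℂ)
    simp only [hexp]
    simpa using h'.const_mul (hIntDeriv z y)

theorem integral_hIntDeriv {z : ℂ} (hz : |z.im| < 1 / 2) :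
    ∫ y in Ioi (0 : ℝ), hIntDeriv z y =
      -(Real.pi * (Complex.sinh (Real.pi * z) / Complex.cosh (Real.pi * z))) := by
  -- In this variable the partial fractions have their poles at integers, and `cot (π w)` is `-i
  -- tanh (π z)`.
  set w : ℂ := 1 / 2 + Complex.I * z with hw
  have hwre : w.re = 1 / 2 - z.im := by simp [hw, sub_eq_add_neg]
  have hz' := abs_lt.1 hz
  have hwmem : w ∈ Complex.integerComplement := by
    rintro ⟨k, hk⟩
    have h := congrArg Complex.re hk
    rw [hwre, Complex.intCast_re] at h
    have h1 : (0 : ℝ) < k := by linarith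
    have h2 : (k : ℝ) < 1 := by linarith
    have h1' : 0 < k := by exact_mod_cast h1
    have h2' : k < 1 := by exact_mod_cast h2
    omega
  -- The terms pair the poles `n + 1` and `-n`, whereas `cotTerm` pairs `n + 1` and `-(n + 1)`; the
  -- regrouping leaves the boundary terms `1 / w - 1 / (w + K)`.
  have hsum : ∀ K : ℕ, ∑ n ∈ Finset.range K, 2 * Complex.I *
      (1 / (2 * n + 1 - 2 * Complex.I * z) - 1 / (2 * n + 1 + 2 * Complex.I * z)) =
      -Complex.I * (∑ n ∈ Finset.range K, cotTerm w n + 1 / w - 1 / (w + K)) := by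
    intro K
    induction K with
    | zero => simp
    | succ K ih =>
      rw [Finset.sum_range_succ, ih, Finset.sum_range_succ, cotTerm]
      have h1 : (2 * K + 1 - 2 * Complex.I * z : ℂ) = -2 * (w - (K + 1)) := by rw [hw]; ring
      have h2 : (2 * K + 1 + 2 * Complex.I * z : ℂ) = 2 * (w + K) := by rw [hw]; ring
      rw [h1, h2]
      simp only [one_div, mul_inv]
      push_cast
      ring
  have hinv : Tendsto (fun K : ℕ => 1 / (w + K)) atTop (𝓝 0) := by
    simp only [one_div]
    refine tendsto_inv₀_cobounded.comp ?_
    exact (tendsto_const_add_cobounded w).comp tendsto_natCast_atTop_cobounded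
  have hlim := ((tendsto_logDeriv_euler_cot_sub hwmem).add_const (1 / w)).sub hinv
    |>.const_mul (-Complex.I)
  have huniq := tendsto_nhds_unique (tendsto_integral_hIntDeriv_mul hz)
    (hlim.congr fun K => by rw [integral_hIntDeriv_mul hz, hsum])
  rw [huniq]
  have hcot : Complex.cot (Real.pi * w) =
      -Complex.I * (Complex.sinh (Real.pi * z) / Complex.cosh (Real.pi * z)) := by
    rw [Complex.cot, show (Real.pi * w : ℂ) = Real.pi * z * Complex.I + Real.pi / 2 by
      rw [hw]; ring, Complex.cos_add_pi_div_two, Complex.sin_add_pi_div_two, Complex.sin_mul_I,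
      Complex.cos_mul_I]
    ring
  rw [hcot]
  linear_combination (Real.pi * (Complex.sinh (Real.pi * z) / Complex.cosh (Real.pi * z))) *
    Complex.I_mul_I

/-- Both sides have the logarithmic derivative `π tanh (π z)` on the connected strip, so their
quotient is constant. The constant is found separately. -/
theorem exp_neg_logInvCosh_eq_mul {z : ℂ} (hz : |z.im| < 1 / 2) :
    Complex.exp (-logInvCosh z) = Complex.exp (-logInvCosh 0) * Complex.cosh (Real.pi * z) := by
  set U : Set ℂ := {z | |z.im| < 1 / 2} with hU
  have hopen : IsOpen U := isOpen_lt Complex.continuous_im.abs continuous_const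
  have hconv : Convex ℝ U := by
    have : U = Complex.imCLM ⁻¹' (Ioo (-(1 / 2)) (1 / 2)) := by
      ext w
      simp [hU, abs_lt]
    rw [this]
    exact (convex_Ioo _ _).is_linear_preimage Complex.imCLM.isLinear
  have hd : ∀ w ∈ U, HasDerivAt (fun w => Complex.exp (-logInvCosh w) / Complex.cosh (Real.pi * w))
      0 w := by
    intro w hw
    have h1 := (hasDerivAt_logInvCosh hw).neg.cexp
    have h2 : HasDerivAt (fun w : ℂ => (Real.pi : ℂ) * w) Real.pi w := by
      simpa using (hasDerivAt_id w).const_mul (Real.pi : ℂ)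
    have h3 := h1.div h2.ccosh (cosh_pi_mul_ne_zero hw)
    refine h3.congr_deriv ?_
    rw [integral_hIntDeriv hw]
    have := cosh_pi_mul_ne_zero hw
    field_simp
    ring
  have hc := hopen.is_const_of_deriv_eq_zero hconv.isPreconnected
    (fun w hw => (hd w hw).differentiableAt.differentiableWithinAt)
    (fun w hw => (hd w hw).deriv) (x := z) (y := 0) hz (by simp [hU])
  rw [div_eq_iff (cosh_pi_mul_ne_zero hz)] at hc
  simpa using hc

/-- At `z = i / 4` the cosine is `cosh (y / 2)`, which cancels against `sinh y = 2 sinh (y / 2) cosh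
(y / 2)`; the result is a rescaled integrand at `0`. This relation determines the value at `0`. -/
theorem logInvCosh_I_div_four : 2 * logInvCosh (Complex.I / 4) = logInvCosh 0 := by
  have h : ∀ y ∈ Ioi (0 : ℝ), hInt (Complex.I / 4) y = 1 / 4 * hInt 0 (1 / 2 * y) := by
    intro y hy
    have hy' : (0 : ℝ) < y := hy
    have h1 : Complex.sinh (y / 2) ≠ 0 := by
      have := sinh_ofReal_mul_ne_zero one_half_pos hy'
      push_cast at this
      rwa [show (y / 2 : ℂ) = 1 / 2 * y by ring]
    have h2 : Complex.cosh (y / 2) ≠ 0 := by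
      have := (Real.cosh_pos (y / 2)).ne'
      rw [← Complex.ofReal_ne_zero] at this
      simpa using this
    have h3 : (y : ℂ) ≠ 0 := by exact_mod_cast hy'.ne'
    have h4 : Complex.sinh y = 2 * Complex.sinh (y / 2) * Complex.cosh (y / 2) := by
      rw [← Complex.sinh_two_mul]; ring_nf
    rw [hInt, hInt, show (2 * y * (Complex.I / 4) : ℂ) = y / 2 * Complex.I by ring,
      Complex.cos_mul_I, h4]
    push_cast
    rw [show (1 / 2 * y : ℂ) = y / 2 by ring, mul_zero, Complex.cos_zero]
    field_simp
    ring
  rw [logInvCosh, setIntegral_congr_fun measurableSet_Ioi h, integral_const_mul,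
    integral_comp_mul_left_Ioi (hInt 0) 0 one_half_pos, mul_zero, ← logInvCosh, Complex.real_smul]
  push_cast
  ring

theorem exp_neg_logInvCosh {z : ℂ} (hz : |z.im| < 1 / 2) :
    Complex.exp (-logInvCosh z) = 2 * Complex.cosh (Real.pi * z) := by
  have h : Complex.exp (-logInvCosh 0) = 2 := by
    have h1 := exp_neg_logInvCosh_eq_mul (z := Complex.I / 4) (by
      rw [show (Complex.I / 4 : ℂ) = ((1 / 4 : ℝ) : ℂ) * Complex.I by push_cast; ring,
        Complex.im_ofReal_mul, Complex.I_im, mul_one]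
      norm_num)
    have h2 : Complex.exp (-logInvCosh (Complex.I / 4)) ^ 2 = Complex.exp (-logInvCosh 0) := by
      rw [← Complex.exp_nat_mul, ← logInvCosh_I_div_four]
      push_cast
      ring_nf
    have h3 : Complex.cosh (Real.pi * (Complex.I / 4)) ^ 2 = 1 / 2 := by
      rw [show (Real.pi * (Complex.I / 4) : ℂ) = (Real.pi / 4 : ℝ) * Complex.I by push_cast; ring,
        Complex.cosh_mul_I, ← Complex.ofReal_cos, Real.cos_pi_div_four, ← Complex.ofReal_pow,
        div_pow, Real.sq_sqrt zero_le_two]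
      norm_num
    rw [h1, mul_pow, h3] at h2
    -- With `E = exp (-logInvCosh 0)`, `h2` now reads `E ^ 2 / 2 = E`, and `E ≠ 0` gives `E = 2`.
    have h4 := Complex.exp_ne_zero (-logInvCosh 0)
    apply mul_left_cancel₀ h4
    linear_combination 2 * h2
  rw [exp_neg_logInvCosh_eq_mul hz, h]

/-- The difference equation in the strip. -/
theorem exp_g_add {a b : ℝ} (ha : 0 < a) (hb : 0 < b) {z : ℂ} (hz : |z.im| < a / 2) :
    Complex.exp (Complex.I * g a b (z + Complex.I * b / 2)) =
      2 * Complex.cosh (Real.pi * z / a) *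
        Complex.exp (Complex.I * g a b (z - Complex.I * b / 2)) := by
  have hz' : |(z / a).im| < 1 / 2 := by
    rw [Complex.div_ofReal_im, abs_div, abs_of_pos ha, div_lt_iff₀ ha]
    linarith
  rw [mul_div_assoc (Real.pi : ℂ), ← exp_neg_logInvCosh hz', ← Complex.exp_add]
  congr 1
  linear_combination Complex.I * g_sub_g ha hb hz + logInvCosh (z / a) * Complex.I_mul_I

theorem g_comm (a b : ℝ) (z : ℂ) : g a b z = g b a z := by
  unfold g
  refine setIntegral_congr_fun measurableSet_Ioi fun y _ => ?_
  rw [mul_right_comm 2 (Complex.sinh (a * y)), mul_comm (a : ℂ) b]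

end HyperbolicRCM

end

/-! ### Both difference equations for `G`, and continuity of `G` and `1 / G` along real
translations. -/

noncomputable section

open MeasureTheory Set Filter Topology

namespace HyperbolicRCM

/-- All zeros of `cosh` are imaginary. Nonzero real part is the genericity condition used below to
stay away from zeros and poles of `G`. -/
theorem cosh_ne_zero_of_re_ne_zero {w : ℂ} (h : w.re ≠ 0) : Complex.cosh w ≠ 0 := by
  intro h0
  obtain ⟨k, hk⟩ := cosh_eq_zero h0
  apply h
  rw [hk, show ((k + 1 / 2) * Real.pi * Complex.I : ℂ) =
    (((k + 1 / 2) * Real.pi : ℝ) : ℂ) * Complex.I by push_cast; ring, Complex.re_ofReal_mul,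
    Complex.I_re, mul_zero]

theorem sinh_ne_zero_of_re_ne_zero {w : ℂ} (h : w.re ≠ 0) : Complex.sinh w ≠ 0 := by
  have h1 := cosh_ne_zero_of_re_ne_zero (w := w + (Real.pi / 2 : ℝ) * Complex.I) (by simpa using h)
  have h2 : Complex.cosh (w + (Real.pi / 2 : ℝ) * Complex.I) = Complex.sinh w * Complex.I := by
    rw [Complex.cosh_add, Complex.cosh_mul_I, Complex.sinh_mul_I, ← Complex.ofReal_cos,
      ← Complex.ofReal_sin, Real.cos_pi_div_two, Real.sin_pi_div_two]
    simp
  rw [h2] at h1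
  exact left_ne_zero_of_mul h1

theorem re_pi_mul_div (z : ℂ) (a : ℝ) : (Real.pi * z / a : ℂ).re = Real.pi * z.re / a := by
  rw [Complex.div_ofReal_re, Complex.re_ofReal_mul]

theorem re_pi_mul_div_ne_zero {z : ℂ} (hz : z.re ≠ 0) {a : ℝ} (ha : 0 < a) :
    (Real.pi * z / a : ℂ).re ≠ 0 := by
  rw [re_pi_mul_div]
  exact div_ne_zero (mul_ne_zero Real.pi_ne_zero hz) ha.ne'

theorem cosh_pi_mul_div_ne_zero {z : ℂ} (hz : z.re ≠ 0) {a : ℝ} (ha : 0 < a) :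
    Complex.cosh (Real.pi * z / a) ≠ 0 :=
  cosh_ne_zero_of_re_ne_zero (re_pi_mul_div_ne_zero hz ha)

/-- The product of the factors acquired by `G` under `n` steps upwards. -/
def upProd (ap am : ℝ) (z : ℂ) (n : ℕ) : ℂ :=
  ∏ j ∈ Finset.range n, 2 * Complex.cosh (Real.pi * (z - (j + 1 / 2) * (Complex.I * ap)) / am)

/-- The product of the factors acquired by `1 / G` under `n` steps downwards. -/
def downProd (ap am : ℝ) (z : ℂ) (n : ℕ) : ℂ :=
  ∏ j ∈ Finset.range n, 2 * Complex.cosh (Real.pi * (z + (j + 1 / 2) * (Complex.I * ap)) / am)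

/-- `n` steps applied to the exponential formula. -/
def stepG (ap am : ℝ) (n : ℤ) (z : ℂ) : ℂ :=
  Complex.exp (Complex.I * g ap am (z - n * (Complex.I * ap))) * upProd ap am z n.toNat /
    downProd ap am z (-n).toNat

theorem G_eq_stepG (ap am : ℝ) (z : ℂ) : G ap am z = stepG ap am (round (z.im / ap)) z := rfl

theorem upProd_succ (ap am : ℝ) (z : ℂ) (n : ℕ) :
    upProd ap am (z + Complex.I * ap) (n + 1) =
      2 * Complex.cosh (Real.pi * (z + Complex.I * ap / 2) / am) * upProd ap am z n := by
  rw [upProd, Finset.prod_range_succ', mul_comm, upProd]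
  congr 1
  · push_cast
    ring_nf
  · refine Finset.prod_congr rfl fun j _ => ?_
    push_cast
    ring_nf

theorem downProd_succ (ap am : ℝ) (z : ℂ) (n : ℕ) :
    downProd ap am z (n + 1) =
      2 * Complex.cosh (Real.pi * (z + Complex.I * ap / 2) / am) *
        downProd ap am (z + Complex.I * ap) n := by
  rw [downProd, Finset.prod_range_succ', mul_comm, downProd]
  congr 1
  · push_cast
    ring_nf
  · refine Finset.prod_congr rfl fun j _ => ?_
    push_cast
    ring_nf

theorem stepG_add (ap am : ℝ) (n : ℤ) {z : ℂ}
    (h : Complex.cosh (Real.pi * (z + Complex.I * ap / 2) / am) ≠ 0) :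
    stepG ap am (n + 1) (z + Complex.I * ap) =
      2 * Complex.cosh (Real.pi * (z + Complex.I * ap / 2) / am) * stepG ap am n z := by
  have h0 : z + Complex.I * ap - ((n + 1 : ℤ) : ℂ) * (Complex.I * ap) =
      z - n * (Complex.I * ap) := by
    push_cast
    ring
  rw [stepG, stepG, h0]
  rcases n with k | k
  · have h1 : (Int.ofNat k + 1).toNat = k + 1 := by simp
    have h2 : (-(Int.ofNat k + 1)).toNat = 0 := by simp
    have h3 : (Int.ofNat k).toNat = k := by simp
    have h4 : (-(Int.ofNat k)).toNat = 0 := by simp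
    rw [h1, h2, h3, h4, upProd_succ]
    simp only [downProd, Finset.range_zero, Finset.prod_empty, div_one]
    ring
  -- For a negative number of steps, one step up removes a factor from the denominator; this
  -- cancellation is where `h` is needed.
  · have h1 : (Int.negSucc k + 1).toNat = 0 := by omega
    have h2 : (-(Int.negSucc k + 1)).toNat = k := by omega
    have h3 : (Int.negSucc k).toNat = 0 := by omega
    have h4 : (-(Int.negSucc k)).toNat = k + 1 := by omega
    rw [h1, h2, h3, h4, downProd_succ]
    simp only [upProd, Finset.range_zero, Finset.prod_empty]
    rw [← mul_div_assoc, mul_div_mul_left _ _ (mul_ne_zero two_ne_zero h)]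

theorem I_mul_im (a : ℝ) : (Complex.I * a).im = a := by simp

theorem I_mul_re (a : ℝ) : (Complex.I * a).re = 0 := by simp

theorem I_mul_div_two_im (a : ℝ) : (Complex.I * a / 2).im = a / 2 := by
  rw [show (Complex.I * a / 2 : ℂ) = Complex.I * (a / 2 : ℝ) by push_cast; ring, I_mul_im]

theorem I_mul_div_two_re (a : ℝ) : (Complex.I * a / 2).re = 0 := by
  rw [show (Complex.I * a / 2 : ℂ) = Complex.I * (a / 2 : ℝ) by push_cast; ring, I_mul_re]

theorem round_im_add {ap : ℝ} (hap : 0 < ap) (z : ℂ) :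
    round ((z + Complex.I * ap).im / ap) = round (z.im / ap) + 1 := by
  rw [Complex.add_im, I_mul_im, add_div, div_self hap.ne', round_add_one]

/-- The difference equation with step `i a_+`. -/
theorem G_add_I_mul_left {ap am : ℝ} (hap : 0 < ap) {z : ℂ}
    (h : Complex.cosh (Real.pi * (z + Complex.I * ap / 2) / am) ≠ 0) :
    G ap am (z + Complex.I * ap) =
      2 * Complex.cosh (Real.pi * (z + Complex.I * ap / 2) / am) * G ap am z := by
  rw [G_eq_stepG, G_eq_stepG, round_im_add hap, stepG_add _ _ _ h]

theorem cosh_add_half_ne_zero {z : ℂ} (hz : z.re ≠ 0) (b : ℝ) {a : ℝ} (ha : 0 < a) :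
    Complex.cosh (Real.pi * (z + Complex.I * b / 2) / a) ≠ 0 :=
  cosh_pi_mul_div_ne_zero (by rwa [Complex.add_re, I_mul_div_two_re, add_zero]) ha

theorem exp_g_add_left {a b : ℝ} (ha : 0 < a) (hb : 0 < b) {z : ℂ}
    (hz : |(z + Complex.I * b / 2).im| < a / 2) :
    Complex.exp (Complex.I * g a b (z + Complex.I * b)) =
      2 * Complex.cosh (Real.pi * (z + Complex.I * b / 2) / a) *
        Complex.exp (Complex.I * g a b z) := by
  have h := exp_g_add ha hb hz
  rwa [add_sub_cancel_right, add_assoc, add_halves] at h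

theorem exp_g_add_right {a b : ℝ} (ha : 0 < a) (hb : 0 < b) {z : ℂ}
    (hz : |(z + Complex.I * a / 2).im| < b / 2) :
    Complex.exp (Complex.I * g a b (z + Complex.I * a)) =
      2 * Complex.cosh (Real.pi * (z + Complex.I * a / 2) / b) *
        Complex.exp (Complex.I * g a b z) := by
  rw [g_comm a b, g_comm a b]
  exact exp_g_add_left hb ha hz

theorem round_le_add_half (x : ℝ) : (round x : ℝ) ≤ x + 1 / 2 := by
  rw [round_eq]
  exact Int.floor_le _

theorem lt_round_add_half (x : ℝ) : x < round x + 1 / 2 := by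
  rw [round_eq]
  linarith [Int.lt_floor_add_one (x + 1 / 2)]

/-- The exponential formula holds in the whole strip. -/
theorem G_eq_exp {ap am : ℝ} (hap : 0 < ap) (ham : 0 < am) {z : ℂ} (hre : z.re ≠ 0)
    (hz : |z.im| < (ap + am) / 2) : G ap am z = Complex.exp (Complex.I * g ap am z) := by
  -- Induction on the number of steps in the definition of `G`. One step towards the real axis stays
  -- in the strip, and there `G` and `exp (i g)` acquire the same factor.
  obtain ⟨n, hn⟩ : ∃ n, (round (z.im / ap)).natAbs = n := ⟨_, rfl⟩
  induction n generalizing z with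
  | zero =>
    rw [G_eq_stepG, Int.natAbs_eq_zero.1 hn]
    simp [stepG, upProd, downProd]
  | succ n ih =>
    have h1 := round_le_add_half (z.im / ap)
    have h2 := lt_round_add_half (z.im / ap)
    rw [abs_lt] at hz
    rcases lt_or_ge (round (z.im / ap)) 0 with hneg | hpos
    · have h3 : (round (z.im / ap) : ℝ) ≤ -1 := by
        exact_mod_cast (by omega : round (z.im / ap) ≤ -1)
      have h4 : z.im < -(ap / 2) := by
        have := (div_lt_iff₀ hap).1 (h2.trans_le (by linarith : _ ≤ -(1 / 2 : ℝ)))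
        linarith
      have h5 := ih (z := z + Complex.I * ap) (by rwa [Complex.add_re, I_mul_re, add_zero])
        (by rw [Complex.add_im, I_mul_im, abs_lt]; constructor <;> linarith)
        (by rw [round_im_add hap]; omega)
      rw [G_add_I_mul_left hap (cosh_add_half_ne_zero hre ap ham), exp_g_add_right hap ham
        (by rw [Complex.add_im, I_mul_div_two_im, abs_lt]; constructor <;> linarith)] at h5
      exact mul_left_cancel₀
        (mul_ne_zero two_ne_zero (cosh_add_half_ne_zero hre ap ham)) h5
    · have h3 : (1 : ℝ) ≤ round (z.im / ap) := by
        exact_mod_cast (by omega : 1 ≤ round (z.im / ap))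
      have h4 : ap / 2 ≤ z.im := by
        have := (le_div_iff₀ hap).1 (by linarith : (1 / 2 : ℝ) ≤ z.im / ap)
        linarith
      obtain ⟨w, rfl⟩ : ∃ w, z = w + Complex.I * ap := ⟨z - Complex.I * ap, by ring⟩
      rw [Complex.add_im, I_mul_im] at hz h4
      rw [Complex.add_re, I_mul_re, add_zero] at hre
      rw [round_im_add hap] at hn hpos
      have h5 : round (w.im / ap) ≠ -1 := fun h => by
        rw [h] at hn
        simp at hn
      rw [G_add_I_mul_left hap (cosh_add_half_ne_zero hre ap ham), exp_g_add_right hap ham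
        (by rw [Complex.add_im, I_mul_div_two_im, abs_lt]; constructor <;> linarith),
        ih hre (by rw [abs_lt]; constructor <;> linarith) (by omega)]

theorem G_add_I_mul_right_aux {ap am : ℝ} (hap : 0 < ap) (ham : 0 < am) {z : ℂ} (hre : z.re ≠ 0)
    (h1 : -(ap / 2) ≤ z.im + am / 2) (h2 : z.im + am / 2 < ap / 2) :
    G ap am (z + Complex.I * am) =
      2 * Complex.cosh (Real.pi * (z + Complex.I * am / 2) / ap) * G ap am z := by
  have hre' : ∀ b : ℝ, (z + Complex.I * b).re ≠ 0 := fun b => by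
    rwa [Complex.add_re, I_mul_re, add_zero]
  have hstrip : |(z + Complex.I * am).im| < (ap + am) / 2 := by
    rw [Complex.add_im, I_mul_im, abs_lt]
    constructor <;> linarith
  rw [G_eq_exp hap ham (hre' am) hstrip]
  rcases h1.lt_or_eq with h1 | h1
  · rw [G_eq_exp hap ham hre (by rw [abs_lt]; constructor <;> linarith), exp_g_add_left hap ham
      (by rw [Complex.add_im, I_mul_div_two_im, abs_lt]; constructor <;> linarith)]
  -- Here `z` lies on the lower edge of the strip, where the formula for `G` by `g` is not
  -- available. Multiplying by the factor of the step `i ap` replaces `G z` by the value at `z + i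
  -- ap`, which is inside.
  · have hstrip' : |(z + Complex.I * ap).im| < (ap + am) / 2 := by
      rw [Complex.add_im, I_mul_im, abs_lt]
      constructor <;> linarith
    apply mul_left_cancel₀ (mul_ne_zero two_ne_zero (cosh_add_half_ne_zero hre ap ham))
    rw [mul_left_comm, ← G_add_I_mul_left hap (cosh_add_half_ne_zero hre ap ham),
      G_eq_exp hap ham (hre' ap) hstrip']
    set F₁ : ℝ → ℂ := fun t => 2 * Complex.cosh (Real.pi * (z + Complex.I * t +
      Complex.I * ap / 2) / am) *
        Complex.exp (Complex.I * g ap am (z + Complex.I * t + Complex.I * am)) with hF₁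
    set F₂ : ℝ → ℂ := fun t => 2 * Complex.cosh (Real.pi * (z + Complex.I * t +
      Complex.I * am / 2) / ap) *
        Complex.exp (Complex.I * g ap am (z + Complex.I * t + Complex.I * ap)) with hF₂
    have hg : ∀ b : ℝ, |(z + Complex.I * b).im| < (ap + am) / 2 →
        ContinuousAt (fun t : ℝ => g ap am (z + Complex.I * t + Complex.I * b)) 0 := by
      intro b hb
      refine ContinuousAt.comp (f := fun t : ℝ => z + Complex.I * t + Complex.I * b)
        (g := g ap am) ?_ (by fun_prop)
      simpa using continuousAt_g hap ham hb
    have hc₁ : ContinuousAt F₁ 0 := by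
      have := hg am hstrip
      fun_prop
    have hc₂ : ContinuousAt F₂ 0 := by
      have := hg ap hstrip'
      fun_prop
    -- Moved up by a small `t > 0`, the point enters the strip, where both sides are the two step
    -- factors times the exponential at `z + i t`.
    have heq : F₁ =ᶠ[𝓝[>] 0] F₂ := by
      filter_upwards [Ioo_mem_nhdsGT (lt_min hap ham)] with t ht
      have ht1 : t < ap := ht.2.trans_le (min_le_left _ _)
      have ht2 : t < am := ht.2.trans_le (min_le_right _ _)
      have ht0 : 0 < t := ht.1
      simp only [hF₁, hF₂]
      rw [exp_g_add_left hap ham, exp_g_add_right hap ham]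
      · ring
      all_goals
        rw [Complex.add_im, Complex.add_im, I_mul_im, I_mul_div_two_im, abs_lt]
        constructor <;> linarith
    have := tendsto_nhds_unique
      ((hc₁.tendsto.mono_left nhdsWithin_le_nhds).congr' heq)
      (hc₂.tendsto.mono_left nhdsWithin_le_nhds)
    simpa [hF₁, hF₂] using this

theorem cosh_pi_mul_add_I_mul_self (z : ℂ) {a : ℝ} (ha : 0 < a) :
    Complex.cosh (Real.pi * (z + Complex.I * a) / a) = -Complex.cosh (Real.pi * z / a) := by
  have : (a : ℂ) ≠ 0 := by exact_mod_cast ha.ne'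
  rw [show (Real.pi * (z + Complex.I * a) / a : ℂ) = Real.pi * z / a + Real.pi * Complex.I by
    field_simp, Complex.cosh_add, Complex.cosh_mul_I, Complex.sinh_mul_I]
  simp

/-- The difference equation with step `i a_-`. -/
theorem G_add_I_mul_right {ap am : ℝ} (hap : 0 < ap) (ham : 0 < am) {z : ℂ} (hre : z.re ≠ 0) :
    G ap am (z + Complex.I * am) =
      2 * Complex.cosh (Real.pi * (z + Complex.I * am / 2) / ap) * G ap am z := by
  -- A translation by `i ap` multiplies both sides by the same factor: on each side one `cosh` is
  -- moved by `i` times its own scale and changes sign, and the signs agree.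
  have step : ∀ w : ℂ, w.re ≠ 0 →
      ((G ap am (w + Complex.I * am) =
        2 * Complex.cosh (Real.pi * (w + Complex.I * am / 2) / ap) * G ap am w) ↔
      (G ap am (w + Complex.I * ap + Complex.I * am) =
        2 * Complex.cosh (Real.pi * (w + Complex.I * ap + Complex.I * am / 2) / ap) *
          G ap am (w + Complex.I * ap))) := by
    intro w hw
    have hw' : (w + Complex.I * am).re ≠ 0 := by rwa [Complex.add_re, I_mul_re, add_zero]
    have hc := cosh_add_half_ne_zero hw ap ham
    rw [add_right_comm w (Complex.I * ap) (Complex.I * am),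
      add_right_comm w (Complex.I * ap) (Complex.I * am / 2),
      G_add_I_mul_left hap (cosh_add_half_ne_zero hw' ap ham), G_add_I_mul_left hap hc,
      add_right_comm w (Complex.I * am) (Complex.I * ap / 2), cosh_pi_mul_add_I_mul_self _ ham,
      cosh_pi_mul_add_I_mul_self _ hap]
    constructor
    · intro h
      rw [h]
      ring
    · intro h
      apply mul_left_cancel₀ (mul_ne_zero two_ne_zero hc)
      linear_combination -h
  have steps : ∀ (k : ℕ) (w : ℂ), w.re ≠ 0 →
      ((G ap am (w + Complex.I * am) =
        2 * Complex.cosh (Real.pi * (w + Complex.I * am / 2) / ap) * G ap am w) ↔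
      (G ap am (w + k * (Complex.I * ap) + Complex.I * am) =
        2 * Complex.cosh (Real.pi * (w + k * (Complex.I * ap) + Complex.I * am / 2) / ap) *
          G ap am (w + k * (Complex.I * ap)))) := by
    intro k w hw
    induction k with
    | zero => simp
    | succ k ih =>
      rw [ih, step _ (by simpa using hw)]
      push_cast
      rw [show w + (k + 1 : ℂ) * (Complex.I * ap) = w + k * (Complex.I * ap) + Complex.I * ap by
        ring]
  -- It is the midpoint `z + i am / 2` that has to be brought to height between `-ap / 2` and `ap /
  -- 2`.
  set n := round ((z.im + am / 2) / ap) with hn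
  have h1 := round_le_add_half ((z.im + am / 2) / ap)
  have h2 := lt_round_add_half ((z.im + am / 2) / ap)
  rw [← hn] at h1 h2
  have h1' : (n - 1 / 2 : ℝ) * ap ≤ z.im + am / 2 := (le_div_iff₀ hap).1 (by linarith)
  have h2' : z.im + am / 2 < (n + 1 / 2 : ℝ) * ap := (div_lt_iff₀ hap).1 h2
  obtain ⟨k, hk | hk⟩ := n.eq_nat_or_neg
  · rw [hk] at h1' h2'
    push_cast at h1' h2'
    have him : (z - k * (Complex.I * ap)).im = z.im - k * ap := by simp
    have hre' : (z - k * (Complex.I * ap)).re ≠ 0 := by simpa using hre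
    have := (steps k (z - k * (Complex.I * ap)) hre').1 (G_add_I_mul_right_aux hap ham hre'
      (by rw [him]; linarith) (by rw [him]; linarith))
    rwa [sub_add_cancel] at this
  · rw [hk] at h1' h2'
    push_cast at h1' h2'
    have him : (z + k * (Complex.I * ap)).im = z.im + k * ap := by simp
    have hre' : (z + k * (Complex.I * ap)).re ≠ 0 := by simpa using hre
    exact (steps k z hre).2 (G_add_I_mul_right_aux hap ham hre'
      (by rw [him]; linarith) (by rw [him]; linarith))

theorem eq_of_cosh_eq_zero {u : ℂ} {a : ℝ} (ha : 0 < a)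
    (h : Complex.cosh (Real.pi * u / a) = 0) :
    ∃ k : ℤ, u = Complex.I * ((k + 1 / 2) * a) := by
  obtain ⟨k, hk⟩ := cosh_eq_zero h
  refine ⟨k, ?_⟩
  have h1 : (a : ℂ) ≠ 0 := by exact_mod_cast ha.ne'
  have h2 : (Real.pi : ℂ) ≠ 0 := by exact_mod_cast Real.pi_ne_zero
  rw [div_eq_iff h1] at hk
  apply mul_left_cancel₀ h2
  linear_combination hk

/-- A vanishing factor puts `z` at `i ((j + 1/2) ap + (k + 1/2) am)` with `k` an integer. The
rounding gives `Im z ≥ (j + 1/2) ap`, which forces `k ≥ 0` and makes `z` a listed zero. -/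
theorem upProd_ne_zero {ap am : ℝ} (hap : 0 < ap) (ham : 0 < am) {z : ℂ}
    (hz : z ∉ zeroSet ap am) : upProd ap am z (round (z.im / ap)).toNat ≠ 0 := by
  refine Finset.prod_ne_zero_iff.2 fun j hj h => hz ?_
  obtain ⟨k, hk⟩ := eq_of_cosh_eq_zero ham ((mul_eq_zero.1 h).resolve_left two_ne_zero)
  have hz' : z = Complex.I * (((j + 1 / 2) * ap + (k + 1 / 2) * am : ℝ) : ℂ) := by
    push_cast
    linear_combination hk
  have him : z.im = (j + 1 / 2) * ap + (k + 1 / 2) * am := by rw [hz', I_mul_im]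
  have h1 := round_le_add_half (z.im / ap)
  have h2 : (j : ℤ) + 1 ≤ round (z.im / ap) := by
    have := Finset.mem_range.1 hj
    omega
  have h2' : (j : ℝ) + 1 ≤ round (z.im / ap) := by exact_mod_cast h2
  have h3 : (j + 1 / 2 : ℝ) * ap ≤ z.im := (le_div_iff₀ hap).1 (by linarith)
  have h4 : 0 ≤ (k + 1 / 2 : ℝ) * am := by linarith
  have h5 : (-1 : ℝ) < k := by linarith [nonneg_of_mul_nonneg_left h4 ham]
  have h6 : -1 < k := by exact_mod_cast h5
  obtain ⟨l, rfl⟩ := Int.eq_ofNat_of_zero_le (by omega : 0 ≤ k)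
  refine ⟨j, l, ?_⟩
  rw [hz']
  push_cast
  ring

theorem downProd_ne_zero {ap am : ℝ} (hap : 0 < ap) (ham : 0 < am) {z : ℂ}
    (hz : z ∉ poleSet ap am) : downProd ap am z (-round (z.im / ap)).toNat ≠ 0 := by
  refine Finset.prod_ne_zero_iff.2 fun j hj h => hz ?_
  obtain ⟨k, hk⟩ := eq_of_cosh_eq_zero ham ((mul_eq_zero.1 h).resolve_left two_ne_zero)
  have hz' : z = Complex.I * ((-((j + 1 / 2) * ap) + (k + 1 / 2) * am : ℝ) : ℂ) := by
    push_cast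
    linear_combination hk
  have him : z.im = -((j + 1 / 2) * ap) + (k + 1 / 2) * am := by rw [hz', I_mul_im]
  have h1 := lt_round_add_half (z.im / ap)
  have h2 : (j : ℤ) + 1 ≤ -round (z.im / ap) := by
    have := Finset.mem_range.1 hj
    omega
  have h2' : (j : ℝ) + 1 ≤ -round (z.im / ap) := by exact_mod_cast h2
  have h3 : z.im < (-(j + 1 / 2) : ℝ) * ap := (div_lt_iff₀ hap).1 (by linarith)
  have h4 : 0 ≤ -(k + 1 / 2 : ℝ) * am := by linarith
  have h5 : (k : ℝ) < 0 := by linarith [nonneg_of_mul_nonneg_left h4 ham]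
  have h6 : k < 0 := by exact_mod_cast h5
  obtain ⟨l, hl⟩ := Int.eq_ofNat_of_zero_le (by omega : 0 ≤ -k - 1)
  refine ⟨j, l, ?_⟩
  have hk' : (k : ℝ) = -l - 1 := by
    have : k = -(l : ℤ) - 1 := by omega
    rw [this]
    push_cast
    ring
  rw [hz', hk']
  push_cast
  ring

/-- Real translations do not change the rounded height, so the piecewise definition of `G` reduces
to a single formula along them. -/
theorem G_add_ofReal (ap am : ℝ) (z : ℂ) :
    (fun t : ℝ => G ap am (z + t)) = fun t : ℝ => stepG ap am (round (z.im / ap)) (z + t) := by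
  funext t
  rw [G_eq_stepG]
  simp

theorem continuousAt_exp_g_add_ofReal {ap am : ℝ} (hap : 0 < ap) (ham : 0 < am) (z : ℂ) :
    ContinuousAt (fun t : ℝ => Complex.exp (Complex.I *
      g ap am (z + t - (round (z.im / ap) : ℂ) * (Complex.I * ap)))) 0 := by
  have hg : ContinuousAt (fun t : ℝ =>
      g ap am (z + t - (round (z.im / ap) : ℂ) * (Complex.I * ap))) 0 := by
    refine ContinuousAt.comp (f := fun t : ℝ => z + t - (round (z.im / ap) : ℂ) * (Complex.I * ap))
      (g := g ap am) ?_ (by fun_prop)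
    refine continuousAt_g hap ham ?_
    have him : (z + (0 : ℝ) - (round (z.im / ap) : ℂ) * (Complex.I * ap)).im =
        z.im - round (z.im / ap) * ap := by simp
    have h1 := round_le_add_half (z.im / ap)
    have h2 := lt_round_add_half (z.im / ap)
    have h1' := (le_div_iff₀ hap).1 (sub_le_iff_le_add.2 h1)
    have h2' := (div_lt_iff₀ hap).1 h2
    rw [him, abs_lt]
    constructor <;> linarith
  fun_prop

theorem continuous_upProd_add (ap am : ℝ) (z : ℂ) (n : ℕ) :
    Continuous fun t : ℝ => upProd ap am (z + t) n := by
  unfold upProd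
  fun_prop

theorem continuous_downProd_add (ap am : ℝ) (z : ℂ) (n : ℕ) :
    Continuous fun t : ℝ => downProd ap am (z + t) n := by
  unfold downProd
  fun_prop

theorem continuousAt_G_add_ofReal {ap am : ℝ} (hap : 0 < ap) (ham : 0 < am) {z : ℂ}
    (hz : z ∉ poleSet ap am) : ContinuousAt (fun t : ℝ => G ap am (z + t)) 0 := by
  rw [G_add_ofReal]
  exact ((continuousAt_exp_g_add_ofReal hap ham z).mul
    (continuous_upProd_add ap am z _).continuousAt).div
    (continuous_downProd_add ap am z _).continuousAt
    (by simpa using downProd_ne_zero hap ham hz)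

/-- At a pole of `G` the default value `0` is also the true value of `1 / G`, so only zeros have to
be excluded. -/
theorem continuousAt_inv_G_add_ofReal {ap am : ℝ} (hap : 0 < ap) (ham : 0 < am) {z : ℂ}
    (hz : z ∉ zeroSet ap am) : ContinuousAt (fun t : ℝ => (G ap am (z + t))⁻¹) 0 := by
  have h : (fun t : ℝ => (G ap am (z + t))⁻¹) =
      fun t : ℝ => downProd ap am (z + t) (-round (z.im / ap)).toNat /
        (Complex.exp (Complex.I * g ap am (z + t - (round (z.im / ap) : ℂ) * (Complex.I * ap))) *
          upProd ap am (z + t) (round (z.im / ap)).toNat) := by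
    funext t
    rw [congrFun (G_add_ofReal ap am z) t, stepG, inv_div]
  rw [h]
  exact (continuous_downProd_add ap am z _).continuousAt.div
    ((continuousAt_exp_g_add_ofReal hap ham z).mul
      (continuous_upProd_add ap am z _).continuousAt)
    (mul_ne_zero (Complex.exp_ne_zero _) (by simpa using upProd_ne_zero hap ham hz))

theorem G_ne_zero_of_re_ne_zero {ap am : ℝ} (ham : 0 < am) {z : ℂ} (hz : z.re ≠ 0) :
    G ap am z ≠ 0 := by
  rw [G_eq_stepG]
  refine div_ne_zero (mul_ne_zero (Complex.exp_ne_zero _) ?_) ?_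
  all_goals
    refine Finset.prod_ne_zero_iff.2 fun j _ => mul_ne_zero two_ne_zero
      (cosh_pi_mul_div_ne_zero ?_ ham)
    simpa using hz

end HyperbolicRCM

end

/-! ### The hyperbolic Cauchy determinant and the identity for equally many variables. -/

noncomputable section

open Finset

namespace HyperbolicRCM

section CauchyDeterminant

variable {N : ℕ}

/-- The hyperbolic Vandermonde product. -/
def sinhVandermonde (x : Fin N → ℂ) : ℂ := ∏ i, ∏ j ∈ Ioi i, Complex.sinh (x j - x i)

/-- The hyperbolic Cauchy determinant. -/
def sinhCauchyDet (x v : Fin N → ℂ) : ℂ :=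
  Matrix.det (Matrix.of fun i j => (Complex.sinh (x i - v j))⁻¹)

theorem prod_prod_Ioi_mul (f : Fin N → ℂ) :
    ∏ i, ∏ j ∈ Ioi i, f i * f j = ∏ i, f i ^ (N - 1) := by
  rw [prod_prod_Ioi_mul_eq_prod_prod_off_diag (fun _ b => f b)]
  refine prod_congr rfl fun i _ => ?_
  rw [prod_const, card_compl, card_singleton, Fintype.card_fin]

/-- Up to factors in one variable each, `sinh` of a difference is a difference of the variables `exp
(2 a)`, so the algebraic Vandermonde determinant applies. -/
theorem sinh_sub_eq (a b : ℂ) :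
    Complex.sinh (a - b) =
      Complex.exp (-a) * (Complex.exp (-b) / 2 * (Complex.exp (2 * a) - Complex.exp (2 * b))) := by
  have h1 : Complex.exp (-(a - b)) = Complex.exp (-a) * Complex.exp (-b) * Complex.exp (2 * b) := by
    rw [← Complex.exp_add, ← Complex.exp_add]; ring_nf
  have h2 : Complex.exp (a - b) = Complex.exp (-a) * Complex.exp (-b) * Complex.exp (2 * a) := by
    rw [← Complex.exp_add, ← Complex.exp_add]; ring_nf
  rw [Complex.sinh, h1, h2]
  ring

theorem sinhVandermonde_eq (x : Fin N → ℂ) :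
    sinhVandermonde x = (∏ i : Fin N, ∏ _j ∈ Ioi i, (1 / 2 : ℂ)) *
      (∏ i, Complex.exp (-x i) ^ (N - 1)) *
        (Matrix.vandermonde fun i => Complex.exp (2 * x i)).det := by
  rw [Matrix.det_vandermonde, ← prod_prod_Ioi_mul, ← prod_mul_distrib, ← prod_mul_distrib,
    sinhVandermonde]
  refine prod_congr rfl fun i _ => ?_
  rw [← prod_mul_distrib, ← prod_mul_distrib]
  refine prod_congr rfl fun j _ => ?_
  rw [sinh_sub_eq]
  ring

/-- As a function of `x`, the determinant is proportional to the Vandermonde product. -/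
theorem exists_det_prod_sinh_eq (v : Fin N → ℂ) : ∃ C : ℂ, ∀ x : Fin N → ℂ,
    Matrix.det (Matrix.of fun i j => ∏ k ∈ univ.erase j, Complex.sinh (x i - v k)) =
      C * sinhVandermonde x := by
  classical
  -- Up to row and column factors, column `j` evaluates a polynomial of degree `N - 1` at the `exp
  -- (2 x i)`; the matrix is then the Vandermonde matrix times the coefficient matrix `B`.
  let p : Fin N → Polynomial ℂ := fun j =>
    ∏ k ∈ univ.erase j, (Polynomial.X - Polynomial.C (Complex.exp (2 * v k)))
  let B : Matrix (Fin N) (Fin N) ℂ := Matrix.of fun l j => (p j).coeff l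
  let d : Fin N → ℂ := fun j => ∏ k ∈ univ.erase j, Complex.exp (-v k) / 2
  have hdeg : ∀ j, (p j).natDegree < N := fun j => by
    have h1 : (p j).natDegree = N - 1 := by
      rw [Polynomial.natDegree_prod _ _ fun k _ => Polynomial.X_sub_C_ne_zero _]
      simp [card_erase_of_mem]
    have := j.pos
    omega
  have hV : (∏ i : Fin N, ∏ _j ∈ Ioi i, (1 / 2 : ℂ)) ≠ 0 :=
    prod_ne_zero_iff.2 fun i _ => prod_ne_zero_iff.2 fun j _ => by norm_num
  refine ⟨(∏ j, d j) * B.det / ∏ i : Fin N, ∏ _j ∈ Ioi i, (1 / 2 : ℂ), fun x => ?_⟩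
  have hM : (Matrix.of fun i j => ∏ k ∈ univ.erase j, Complex.sinh (x i - v k)) =
      Matrix.of fun i j => Complex.exp (-x i) ^ (N - 1) *
        (Matrix.of fun i j => d j *
          (Matrix.vandermonde (fun i => Complex.exp (2 * x i)) * B) i j) i j := by
    ext i j
    have h1 : (Matrix.vandermonde (fun i => Complex.exp (2 * x i)) * B) i j =
        (p j).eval (Complex.exp (2 * x i)) := by
      rw [Polynomial.eval_eq_sum_range' (hdeg j), Matrix.mul_apply, sum_range]
      refine sum_congr rfl fun l _ => ?_
      simp [B, Matrix.vandermonde_apply, mul_comm]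
    simp only [Matrix.of_apply]
    rw [h1, Polynomial.eval_prod, ← prod_mul_distrib]
    simp only [sinh_sub_eq (x i)]
    rw [prod_mul_distrib, prod_const, card_erase_of_mem (mem_univ j), card_univ, Fintype.card_fin]
    simp
  rw [hM, Matrix.det_mul_column, Matrix.det_mul_row, Matrix.det_mul, sinhVandermonde_eq]
  field_simp

theorem sinhVandermonde_ne_zero {x : Fin N → ℂ}
    (hx : ∀ i j, i ≠ j → Complex.sinh (x i - x j) ≠ 0) : sinhVandermonde x ≠ 0 :=
  prod_ne_zero_iff.2 fun i _ => prod_ne_zero_iff.2 fun j hj =>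
    hx j i (ne_of_gt (mem_Ioi.1 hj))

theorem prod_mul_sinhCauchyDet {x v : Fin N → ℂ} (h : ∀ i j, Complex.sinh (x i - v j) ≠ 0) :
    (∏ i, ∏ j, Complex.sinh (x i - v j)) * sinhCauchyDet x v =
      Matrix.det (Matrix.of fun i j => ∏ k ∈ univ.erase j, Complex.sinh (x i - v k)) := by
  rw [sinhCauchyDet, ← Matrix.det_mul_column]
  congr 1
  ext i j
  simp only [Matrix.of_apply]
  rw [← mul_prod_erase univ _ (mem_univ j), mul_comm, inv_mul_cancel_left₀ (h i j)]

/-- The explicit Cauchy determinant, up to a factor that depends only on `v`. -/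
theorem exists_prod_mul_sinhCauchyDet_eq {v : Fin N → ℂ}
    (hv : ∀ i j, i ≠ j → Complex.sinh (v i - v j) ≠ 0) : ∃ C : ℂ, C ≠ 0 ∧ ∀ x : Fin N → ℂ,
    (∀ i j, Complex.sinh (x i - v j) ≠ 0) →
      (∏ i, ∏ j, Complex.sinh (x i - v j)) * sinhCauchyDet x v = C * sinhVandermonde x := by
  obtain ⟨C, hC⟩ := exists_det_prod_sinh_eq v
  refine ⟨C, fun h0 => ?_, fun x hx => (prod_mul_sinhCauchyDet hx).trans (hC x)⟩
  -- At `x = v` the matrix is diagonal with nonzero entries, which shows `C ≠ 0`.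
  have h1 := hC v
  have h2 : (Matrix.of fun i j => ∏ k ∈ univ.erase j, Complex.sinh (v i - v k)) =
      Matrix.diagonal fun j => ∏ k ∈ univ.erase j, Complex.sinh (v j - v k) := by
    ext i j
    rcases eq_or_ne i j with rfl | hij
    · simp
    · rw [Matrix.diagonal_apply_ne _ hij, Matrix.of_apply]
      exact prod_eq_zero (mem_erase.2 ⟨hij, mem_univ i⟩) (by simp)
  rw [h2, Matrix.det_diagonal, h0, zero_mul] at h1
  refine absurd h1 (prod_ne_zero_iff.2 fun j _ => prod_ne_zero_iff.2 fun k hk => ?_)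
  exact hv j k (ne_of_mem_erase hk).symm

/-- The effect of a shift of the variables in `I` on the Vandermonde product. -/
theorem sinhVandermonde_shift {x : Fin N → ℂ} (ρ : ℂ)
    (hx : ∀ i j, i ≠ j → Complex.sinh (x i - x j) ≠ 0) (I : Finset (Fin N)) :
    sinhVandermonde (fun m => if m ∈ I then x m - ρ else x m) =
      (∏ m ∈ I, ∏ n ∈ Iᶜ, Complex.sinh (x m - x n - ρ) / Complex.sinh (x m - x n)) *
        sinhVandermonde x := by
  -- Weights on all ordered pairs, trivial off `I × Iᶜ`, so that the product can be regrouped over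
  -- pairs `i < j`.
  set q : Fin N → Fin N → ℂ := fun m n => if m ∈ I ∧ n ∉ I then
    Complex.sinh (x m - x n - ρ) / Complex.sinh (x m - x n) else 1 with hq
  have h1 : ∏ m ∈ I, ∏ n ∈ Iᶜ, Complex.sinh (x m - x n - ρ) / Complex.sinh (x m - x n) =
      ∏ i, ∏ j ∈ Ioi i, q j i * q i j := by
    rw [prod_prod_Ioi_mul_eq_prod_prod_off_diag]
    have h2 : ∀ i, ∏ j ∈ ({i} : Finset (Fin N))ᶜ, q j i = ∏ j, q j i := fun i => by
      rw [Fintype.prod_eq_mul_prod_compl i]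
      simp [hq]
    simp only [h2]
    rw [prod_comm (f := fun i j => q j i), ← prod_mul_prod_compl I (fun m => ∏ n, q m n),
      prod_eq_one (s := Iᶜ) (f := fun m => ∏ n, q m n), mul_one]
    · refine prod_congr rfl fun m hm => ?_
      rw [← prod_mul_prod_compl I (q m), prod_eq_one (s := I) (f := q m), one_mul]
      · refine prod_congr rfl fun n hn => ?_
        simp [hq, hm, mem_compl.1 hn]
      · intro n hn
        simp [hq, hn]
    · intro m hm
      simp [hq, mem_compl.1 hm]
  rw [h1, sinhVandermonde, sinhVandermonde, ← prod_mul_distrib]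
  refine prod_congr rfl fun i _ => ?_
  rw [← prod_mul_distrib]
  refine prod_congr rfl fun j hj => ?_
  have hij := hx j i (ne_of_gt (mem_Ioi.1 hj))
  have hji := hx i j (ne_of_lt (mem_Ioi.1 hj))
  have e1 : Complex.sinh (x j - x i) = -Complex.sinh (x i - x j) := by
    rw [← Complex.sinh_neg, neg_sub]
  have e2 : Complex.sinh (x j - (x i - ρ)) = -Complex.sinh (x i - x j - ρ) := by
    rw [← Complex.sinh_neg]
    ring_nf
  by_cases hi : i ∈ I <;> by_cases hj' : j ∈ I <;> simp only [hq, hi, hj', if_true, if_false,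
    not_true, not_false_eq_true, and_true, and_false, and_self, one_mul, mul_one,
    sub_sub_sub_cancel_right]
  · rw [e2, e1]
    field_simp
  · rw [sub_right_comm, div_mul_cancel₀ _ hij]

theorem sinhCauchyDet_ne_zero {x v : Fin N → ℂ}
    (hx : ∀ i j, i ≠ j → Complex.sinh (x i - x j) ≠ 0)
    (hv : ∀ i j, i ≠ j → Complex.sinh (v i - v j) ≠ 0)
    (h : ∀ i j, Complex.sinh (x i - v j) ≠ 0) : sinhCauchyDet x v ≠ 0 := by
  obtain ⟨C, hC0, hC⟩ := exists_prod_mul_sinhCauchyDet_eq hv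
  have h1 := hC x h
  intro h0
  rw [h0, mul_zero] at h1
  exact mul_ne_zero hC0 (sinhVandermonde_ne_zero hx) h1.symm

/-- The Vandermonde numerator yields the coefficient of the difference operator and the denominator
yields the product over `v`; the unknown constant depends on `v` only and drops out. -/
theorem sinhCauchyDet_shift {x v : Fin N → ℂ} {ρ : ℂ}
    (hx : ∀ i j, i ≠ j → Complex.sinh (x i - x j) ≠ 0)
    (hv : ∀ i j, i ≠ j → Complex.sinh (v i - v j) ≠ 0)
    (h : ∀ i j, Complex.sinh (x i - v j) ≠ 0) (h' : ∀ i j, Complex.sinh (x i - v j - ρ) ≠ 0)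
    (I : Finset (Fin N)) :
    sinhCauchyDet (fun m => if m ∈ I then x m - ρ else x m) v =
      ((∏ m ∈ I, ∏ n ∈ Iᶜ, Complex.sinh (x m - x n - ρ) / Complex.sinh (x m - x n)) *
        ∏ m ∈ I, ∏ n, Complex.sinh (x m - v n) / Complex.sinh (x m - v n - ρ)) *
        sinhCauchyDet x v := by
  obtain ⟨C, hC0, hC⟩ := exists_prod_mul_sinhCauchyDet_eq hv
  set x' : Fin N → ℂ := fun m => if m ∈ I then x m - ρ else x m with hx'
  have hs : ∀ i j, Complex.sinh (x' i - v j) ≠ 0 := fun i j => by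
    by_cases hi : i ∈ I
    · simpa [hx', hi, sub_right_comm] using h' i j
    · simpa [hx', hi] using h i j
  have h1 := hC x h
  have h2 := hC x' hs
  rw [sinhVandermonde_shift ρ hx] at h2
  have h3 : ∏ i, ∏ j, Complex.sinh (x i - v j) =
      (∏ m ∈ I, ∏ n, Complex.sinh (x m - v n) / Complex.sinh (x m - v n - ρ)) *
        ∏ i, ∏ j, Complex.sinh (x' i - v j) := by
    rw [← prod_mul_prod_compl I (fun i => ∏ j, Complex.sinh (x i - v j)),
      ← prod_mul_prod_compl I (fun i => ∏ j, Complex.sinh (x' i - v j)), ← mul_assoc,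
      ← prod_mul_distrib]
    congr 1
    · refine prod_congr rfl fun m hm => ?_
      rw [← prod_mul_distrib]
      refine prod_congr rfl fun n _ => ?_
      simp only [hx', hm, if_true]
      rw [sub_right_comm (x m) ρ, div_mul_cancel₀ _ (h' m n)]
    · refine prod_congr rfl fun m hm => ?_
      simp [hx', mem_compl.1 hm]
  have h4 : ∏ i, ∏ j, Complex.sinh (x' i - v j) ≠ 0 :=
    prod_ne_zero_iff.2 fun i _ => prod_ne_zero_iff.2 fun j _ => hs i j
  apply mul_left_cancel₀ h4
  rw [h3] at h1
  rw [h2]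
  linear_combination (-(∏ m ∈ I, ∏ n ∈ Iᶜ,
    Complex.sinh (x m - x n - ρ) / Complex.sinh (x m - x n))) * h1

/-- Transposition exchanges the roles of the two sets of variables, so column shifts reduce to row
shifts. -/
theorem sinhCauchyDet_neg_neg (x v : Fin N → ℂ) :
    sinhCauchyDet (fun i => -v i) (fun i => -x i) = sinhCauchyDet x v := by
  rw [sinhCauchyDet, sinhCauchyDet, ← Matrix.det_transpose]
  congr 1
  ext i j
  simp only [Matrix.transpose_apply, Matrix.of_apply]
  congr 2
  ring

/-- Multilinearity in the rows: `I` is the set of rows taken from `B₁`. -/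
theorem det_add_smul (B₀ B₁ : Matrix (Fin N) (Fin N) ℂ) (u : ℂ) :
    Matrix.det (B₀ + u • B₁) =
      ∑ I : Finset (Fin N), u ^ #I *
        Matrix.det (Matrix.of fun i j => if i ∈ I then B₁ i j else B₀ i j) := by
  rw [add_comm]
  refine (Matrix.detRowAlternating.map_add_univ (u • B₁) B₀).trans ?_
  refine sum_congr rfl fun I _ => ?_
  have h1 : u ^ #I = ∏ i, if i ∈ I then u else 1 := by
    rw [prod_ite_mem, univ_inter, prod_const]
  rw [h1, ← Matrix.det_mul_column]
  change Matrix.det _ = _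
  congr 1
  ext i j
  by_cases hi : i ∈ I <;> simp [Finset.piecewise, hi]

end CauchyDeterminant

/-- The symbol of the difference operators, applied to a product of single variable factors. -/
def subsetSum {M : ℕ} (k : ℕ) (x : Fin M → ℂ) (ρ : ℂ) (f : Fin M → ℂ) : ℂ :=
  ∑ I ∈ powersetCard k (univ : Finset (Fin M)),
    (∏ m ∈ I, ∏ n ∈ Iᶜ, Complex.sinh (x m - x n - ρ) / Complex.sinh (x m - x n)) *
      ∏ m ∈ I, f m

theorem sum_powersetCard_eq_of_generating {M : ℕ} {w w' : Finset (Fin M) → ℂ}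
    (h : ∀ u : ℂ, ∑ I, u ^ #I * w I = ∑ I, u ^ #I * w' I) (k : ℕ) :
    ∑ I ∈ powersetCard k univ, w I = ∑ I ∈ powersetCard k univ, w' I := by
  have hp : ∑ I, Polynomial.C (w I) * Polynomial.X ^ #I =
      ∑ I, Polynomial.C (w' I) * Polynomial.X ^ #I := by
    refine Polynomial.funext fun u => ?_
    simp only [Polynomial.eval_finsetSum, Polynomial.eval_mul, Polynomial.eval_C,
      Polynomial.eval_pow, Polynomial.eval_X]
    simpa only [mul_comm] using h u
  have hc := congrArg (fun p => Polynomial.coeff p k) hp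
  simp only [Polynomial.finsetSum_coeff, Polynomial.coeff_C_mul_X_pow] at hc
  rw [← sum_filter, ← sum_filter] at hc
  simpa only [eq_comm (a := k), univ_filter_card_eq] using hc

/-- The kernel identity for equal numbers of variables. -/
theorem subsetSum_eq_subsetSum {N : ℕ} {x v : Fin N → ℂ} {ρ : ℂ}
    (hx : ∀ i j, i ≠ j → Complex.sinh (x i - x j) ≠ 0)
    (hv : ∀ i j, i ≠ j → Complex.sinh (v i - v j) ≠ 0)
    (h : ∀ i j, Complex.sinh (x i - v j) ≠ 0) (h' : ∀ i j, Complex.sinh (x i - v j + ρ) ≠ 0)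
    (k : ℕ) :
    subsetSum k x ρ (fun m => ∏ n, Complex.sinh (x m - v n + ρ) / Complex.sinh (x m - v n)) =
      subsetSum k v (-ρ)
        (fun n => ∏ m, Complex.sinh (x m - v n + ρ) / Complex.sinh (x m - v n)) := by
  refine sum_powersetCard_eq_of_generating (fun u => ?_) k
  -- With this choice the shift `x ↦ x - ρ` turns `sinh (x - v + ρ)` into `sinh (x - v)`, giving the
  -- quotient in the statement.
  set t : Fin N → ℂ := fun n => v n - ρ with ht
  have ht1 : ∀ i j, i ≠ j → Complex.sinh (t i - t j) ≠ 0 := fun i j hij => by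
    simpa [ht] using hv i j hij
  have ht2 : ∀ i j, Complex.sinh (x i - t j) ≠ 0 := fun i j => by
    simpa [ht, sub_sub_eq_add_sub, add_sub_right_comm] using h' i j
  have ht3 : ∀ i j, Complex.sinh (x i - t j - ρ) ≠ 0 := fun i j => by
    rw [show x i - t j - ρ = x i - v j by simp only [ht]; ring]
    exact h i j
  have hD := sinhCauchyDet_ne_zero hx ht1 ht2
  set B₀ : Matrix (Fin N) (Fin N) ℂ := Matrix.of fun i j => (Complex.sinh (x i - t j))⁻¹
  set B₁ : Matrix (Fin N) (Fin N) ℂ := Matrix.of fun i j => (Complex.sinh (x i - t j - ρ))⁻¹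
  apply mul_right_cancel₀ hD
  have hL : (∑ I, u ^ #I * ((∏ m ∈ I, ∏ n ∈ Iᶜ,
      Complex.sinh (x m - x n - ρ) / Complex.sinh (x m - x n)) *
        ∏ m ∈ I, ∏ n, Complex.sinh (x m - v n + ρ) / Complex.sinh (x m - v n))) *
          sinhCauchyDet x t = Matrix.det (B₀ + u • B₁) := by
    rw [det_add_smul, sum_mul]
    refine sum_congr rfl fun I _ => ?_
    rw [mul_assoc]
    congr 1
    have h1 := sinhCauchyDet_shift hx ht1 ht2 ht3 I
    have h2 : ∀ m n, Complex.sinh (x m - t n) / Complex.sinh (x m - t n - ρ) =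
        Complex.sinh (x m - v n + ρ) / Complex.sinh (x m - v n) := fun m n => by
      simp only [ht]
      congr 2 <;> ring
    simp only [h2] at h1
    rw [← h1, sinhCauchyDet]
    congr 1
    ext i j
    by_cases hi : i ∈ I <;> simp [B₀, B₁, hi, sub_right_comm]
  have hR : (∑ I, u ^ #I * ((∏ m ∈ I, ∏ n ∈ Iᶜ,
      Complex.sinh (v m - v n - -ρ) / Complex.sinh (v m - v n)) *
        ∏ n ∈ I, ∏ m, Complex.sinh (x m - v n + ρ) / Complex.sinh (x m - v n))) *
          sinhCauchyDet x t = Matrix.det (B₀ + u • B₁) := by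
    -- The same determinant is expanded by columns: the shift now acts on `-t`, and `-x` plays the
    -- part of the fixed variables.
    rw [← Matrix.det_transpose, Matrix.transpose_add, Matrix.transpose_smul, det_add_smul, sum_mul]
    refine sum_congr rfl fun I _ => ?_
    rw [mul_assoc]
    congr 1
    have e1 : ∀ i j, -t i - -x j = x j - t i := fun i j => by ring
    have h1 := sinhCauchyDet_shift (x := fun i => -t i) (v := fun i => -x i) (ρ := ρ)
      (fun i j hij => by
        have := ht1 j i hij.symm
        rwa [show -t i - -t j = t j - t i by ring])
      (fun i j hij => by
        have := hx j i hij.symm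
        rwa [show -x i - -x j = x j - x i by ring])
      (fun i j => by rw [e1]; exact ht2 j i) (fun i j => by rw [e1]; exact ht3 j i) I
    have h2 : ∀ m n, Complex.sinh (x n - t m) / Complex.sinh (x n - t m - ρ) =
        Complex.sinh (x n - v m + ρ) / Complex.sinh (x n - v m) := fun m n => by
      simp only [ht]
      congr 2 <;> ring
    have h3 : ∀ m n, Complex.sinh (-t m - -t n - ρ) / Complex.sinh (-t m - -t n) =
        Complex.sinh (v m - v n - -ρ) / Complex.sinh (v m - v n) := fun m n => by
      rw [show -t m - -t n - ρ = -(v m - v n - -ρ) by simp only [ht]; ring,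
        show -t m - -t n = -(v m - v n) by simp only [ht]; ring, Complex.sinh_neg,
        Complex.sinh_neg, neg_div_neg_eq]
    simp only [e1, h2, h3] at h1
    rw [sinhCauchyDet_neg_neg] at h1
    rw [← h1, sinhCauchyDet]
    congr 1
    ext i j
    by_cases hi : i ∈ I <;> simp [B₀, B₁, hi]
    all_goals congr 1; ring
  rw [hL, hR]

end HyperbolicRCM

end

/-! ### Fewer `y` variables: one variable is sent to infinity. -/

noncomputable section

open Finset Filter Topology

namespace HyperbolicRCM

theorem tendsto_sinh_add_div_sinh (a ρ : ℂ) :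
    Tendsto (fun w : ℝ => Complex.sinh (w - a + ρ) / Complex.sinh (w - a)) atTop
      (𝓝 (Complex.exp ρ)) := by
  have h0 : Tendsto (fun w : ℝ => Complex.exp (-2 * (w - a))) atTop (𝓝 0) := by
    rw [Complex.tendsto_exp_nhds_zero_iff]
    have h1 : ∀ w : ℝ, (-2 * (w - a) : ℂ).re = -2 * w + 2 * a.re := fun w => by
      simp
      ring
    simp only [h1]
    exact tendsto_atBot_add_const_right _ _ (tendsto_id.const_mul_atTop_of_neg (by norm_num))
  have h1 : Tendsto (fun w : ℝ => (Complex.exp ρ - Complex.exp (-ρ) * Complex.exp (-2 * (w - a))) /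
      (1 - Complex.exp (-2 * (w - a)))) atTop
      (𝓝 ((Complex.exp ρ - Complex.exp (-ρ) * 0) / (1 - 0))) :=
    (tendsto_const_nhds.sub (h0.const_mul _)).div (tendsto_const_nhds.sub h0) (by simp)
  simp only [mul_zero, sub_zero, div_one] at h1
  refine h1.congr fun w => ?_
  have h2 : Complex.exp (-(w - a)) = Complex.exp (w - a) * Complex.exp (-2 * (w - a)) := by
    rw [← Complex.exp_add]; ring_nf
  have h3 : Complex.exp (-(w - a + ρ)) =
      Complex.exp (w - a) * (Complex.exp (-ρ) * Complex.exp (-2 * (w - a))) := by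
    rw [← Complex.exp_add, ← Complex.exp_add]; ring_nf
  rw [Complex.sinh, Complex.sinh, h2, h3, Complex.exp_add, ← mul_sub,
    show Complex.exp (w - a) - Complex.exp (w - a) * Complex.exp (-2 * (w - a)) =
      Complex.exp (w - a) * (1 - Complex.exp (-2 * (w - a))) by ring,
    div_div_div_cancel_right₀ two_ne_zero, mul_div_mul_left _ _ (Complex.exp_ne_zero _)]

theorem tendsto_sinh_sub_add_div_sinh (a ρ : ℂ) :
    Tendsto (fun w : ℝ => Complex.sinh (a - w + ρ) / Complex.sinh (a - w)) atTop
      (𝓝 (Complex.exp (-ρ))) := by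
  refine (tendsto_sinh_add_div_sinh a (-ρ)).congr fun w => ?_
  rw [show (w - a + -ρ : ℂ) = -(a - w + ρ) by ring, show (w - a : ℂ) = -(a - w) by ring,
    Complex.sinh_neg, Complex.sinh_neg, neg_div_neg_eq]

theorem eventually_sinh_sub_ne_zero (a : ℂ) :
    ∀ᶠ w : ℝ in atTop, Complex.sinh (a - w) ≠ 0 := by
  filter_upwards [eventually_gt_atTop a.re] with w hw
  exact sinh_ne_zero_of_re_ne_zero (by simpa using (sub_neg.2 hw).ne)

/-- The elementary symmetric functions of `exp ((l - 1 - 2 i) ρ)`, `i = 0, …, l - 1`. -/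
def expESymm (ρ : ℂ) (l j : ℕ) : ℂ :=
  ((Multiset.range l).map fun i : ℕ => Complex.exp (((l : ℂ) - 1 - 2 * i) * ρ)).esymm j

theorem esymm_zero_right (m : Multiset ℂ) : m.esymm 0 = 1 := by
  simp [Multiset.esymm]

theorem esymm_cons_succ (a : ℂ) (m : Multiset ℂ) (j : ℕ) :
    (a ::ₘ m).esymm (j + 1) = m.esymm (j + 1) + a * m.esymm j := by
  simp [Multiset.esymm, Multiset.powersetCard_cons, Multiset.map_map, Multiset.sum_map_mul_left]

theorem expESymm_zero_right (ρ : ℂ) (l : ℕ) : expESymm ρ l 0 = 1 := esymm_zero_right _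

theorem expESymm_eq_zero (ρ : ℂ) {l j : ℕ} (h : l < j) : expESymm ρ l j = 0 := by
  rw [expESymm, Multiset.esymm, Multiset.powersetCard_eq_empty _ (by simpa using h)]
  simp

/-- The last of the `l + 1` numbers is `exp (-l ρ)`; the others are `exp ρ` times the numbers for
`l`, and homogeneity extracts the powers. -/
theorem expESymm_succ_succ (ρ : ℂ) (l j : ℕ) :
    expESymm ρ (l + 1) (j + 1) = Complex.exp ((j + 1) * ρ) * expESymm ρ l (j + 1) +
      Complex.exp ((j - l) * ρ) * expESymm ρ l j := by
  have h1 : ((Multiset.range l).map fun i : ℕ =>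
      Complex.exp (((l + 1 : ℕ) - 1 - 2 * i : ℂ) * ρ)) =
      ((Multiset.range l).map fun i : ℕ => Complex.exp (((l : ℂ) - 1 - 2 * i) * ρ)).map
        (Complex.exp ρ • ·) := by
    rw [Multiset.map_map]
    refine Multiset.map_congr rfl fun i _ => ?_
    simp only [Function.comp, smul_eq_mul]
    rw [← Complex.exp_add]
    congr 1
    push_cast
    ring
  rw [expESymm, Multiset.range_succ, Multiset.map_cons, h1, esymm_cons_succ,
    ← Multiset.pow_smul_esymm, ← Multiset.pow_smul_esymm, ← expESymm, ← expESymm, smul_eq_mul,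
    smul_eq_mul, ← mul_assoc, ← Complex.exp_nat_mul, ← Complex.exp_nat_mul, ← Complex.exp_add]
  push_cast
  congr 3
  ring

theorem subsetSum_zero {M : ℕ} (x : Fin M → ℂ) (ρ : ℂ) (f : Fin M → ℂ) :
    subsetSum 0 x ρ f = 1 := by
  simp [subsetSum]

theorem compl_map_succEmb {M : ℕ} (I : Finset (Fin M)) :
    (I.map (Fin.succEmb M))ᶜ = insert 0 (Iᶜ.map (Fin.succEmb M)) := by
  ext i
  refine Fin.cases ?_ (fun i => ?_) i <;> simp

theorem compl_insert_map_succEmb {M : ℕ} (I : Finset (Fin M)) :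
    (insert 0 (I.map (Fin.succEmb M)))ᶜ = Iᶜ.map (Fin.succEmb M) := by
  ext i
  refine Fin.cases ?_ (fun i => ?_) i <;> simp

theorem zero_notMem_map_succEmb {M : ℕ} (I : Finset (Fin M)) :
    (0 : Fin (M + 1)) ∉ I.map (Fin.succEmb M) := by
  simp

theorem sum_powersetCard_fin_succ {M : ℕ} (k : ℕ) (h : Finset (Fin (M + 1)) → ℂ) :
    ∑ I ∈ powersetCard (k + 1) univ, h I =
      ∑ I ∈ powersetCard (k + 1) (univ : Finset (Fin M)), h (I.map (Fin.succEmb M)) +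
        ∑ I ∈ powersetCard k (univ : Finset (Fin M)), h (insert 0 (I.map (Fin.succEmb M))) := by
  have hu : (univ : Finset (Fin (M + 1))) = insert 0 (univ.map (Fin.succEmb M)) := by
    ext i
    refine Fin.cases ?_ (fun i => ?_) i <;> simp
  have h0 := zero_notMem_map_succEmb (univ : Finset (Fin M))
  rw [hu, powersetCard_succ_insert h0, sum_union, sum_image, powersetCard_map, powersetCard_map,
    sum_map, sum_map]
  · rfl
  · intro s hs t ht hst
    have hs0 : (0 : Fin (M + 1)) ∉ s := fun hm => h0 ((mem_powersetCard.1 hs).1 hm)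
    have ht0 : (0 : Fin (M + 1)) ∉ t := fun hm => h0 ((mem_powersetCard.1 ht).1 hm)
    rw [← erase_insert hs0, ← erase_insert ht0, hst]
  · rw [disjoint_left]
    intro s hs hs'
    obtain ⟨t, _, rfl⟩ := mem_image.1 hs'
    exact h0 ((mem_powersetCard.1 hs).1 (mem_insert_self _ _))

/-- The weights with one additional variable `w`, split according to whether `w` is shifted. -/
theorem subsetSum_cons {M : ℕ} (k : ℕ) (w : ℂ) (v : Fin M → ℂ) (ρ : ℂ) (f : Fin (M + 1) → ℂ) :
    subsetSum (k + 1) (Fin.cons w v : Fin (M + 1) → ℂ) ρ f =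
      ∑ I ∈ powersetCard (k + 1) (univ : Finset (Fin M)),
        ((∏ m ∈ I, ∏ n ∈ Iᶜ, Complex.sinh (v m - v n - ρ) / Complex.sinh (v m - v n)) *
          ∏ m ∈ I, f m.succ) *
            ∏ m ∈ I, Complex.sinh (v m - w - ρ) / Complex.sinh (v m - w) +
      ∑ I ∈ powersetCard k (univ : Finset (Fin M)),
        ((∏ m ∈ I, ∏ n ∈ Iᶜ, Complex.sinh (v m - v n - ρ) / Complex.sinh (v m - v n)) *
          ∏ m ∈ I, f m.succ) *
            (f 0 * ∏ n ∈ Iᶜ, Complex.sinh (w - v n - ρ) / Complex.sinh (w - v n)) := by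
  rw [subsetSum, sum_powersetCard_fin_succ]
  congr 1
  · refine sum_congr rfl fun I _ => ?_
    rw [compl_map_succEmb, prod_map, prod_map]
    simp only [prod_insert (zero_notMem_map_succEmb _), prod_map, Fin.coe_succEmb, Fin.cons_succ,
      Fin.cons_zero, prod_mul_distrib]
    ring
  · refine sum_congr rfl fun I _ => ?_
    rw [compl_insert_map_succEmb, prod_insert (zero_notMem_map_succEmb _),
      prod_insert (zero_notMem_map_succEmb _)]
    simp only [prod_map, Fin.coe_succEmb, Fin.cons_succ, Fin.cons_zero]
    ring

/-- If `w` is not shifted, each of the `k + 1` shifted variables contributes `exp (-ρ)`. If it is,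
the `N` quotients with `x` contribute `exp (-ρ)` each and the `M - k` unshifted `v` contribute `exp
ρ` each. -/
theorem tendsto_subsetSum_right {M N : ℕ} (k : ℕ) (x : Fin N → ℂ) (v : Fin M → ℂ) (ρ : ℂ)
    (F : Fin M → ℂ) :
    Tendsto (fun w : ℝ => subsetSum (k + 1) (Fin.cons (w : ℂ) v : Fin (M + 1) → ℂ) (-ρ)
      (Fin.cons (∏ m, Complex.sinh (x m - w + ρ) / Complex.sinh (x m - w)) F : Fin (M + 1) → ℂ))
      atTop (𝓝 (Complex.exp (-(k + 1) * ρ) * subsetSum (k + 1) v (-ρ) F +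
        Complex.exp ((M - N - k) * ρ) * subsetSum k v (-ρ) F)) := by
  simp only [subsetSum_cons, Fin.cons_zero, Fin.cons_succ, sub_neg_eq_add]
  refine Tendsto.add ?_ ?_
  · rw [subsetSum, mul_sum]
    refine tendsto_finsetSum _ fun I hI => ?_
    simp only [sub_neg_eq_add]
    have h := tendsto_finsetProd I fun m _ => tendsto_sinh_sub_add_div_sinh (v m) ρ
    rw [prod_const, (mem_powersetCard.1 hI).2, ← Complex.exp_nat_mul] at h
    rw [mul_comm (Complex.exp _)]
    have e : ((k + 1 : ℕ) : ℂ) * -ρ = -(k + 1) * ρ := by push_cast; ring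
    rw [e] at h
    exact h.const_mul _
  · rw [subsetSum, mul_sum]
    refine tendsto_finsetSum _ fun I hI => ?_
    simp only [sub_neg_eq_add]
    have h := (tendsto_finsetProd univ fun m _ => tendsto_sinh_sub_add_div_sinh (x m) ρ).mul
      (tendsto_finsetProd Iᶜ fun n _ => tendsto_sinh_add_div_sinh (v n) ρ)
    have hk := (mem_powersetCard.1 hI).2
    have hle : k ≤ M := by
      rw [← hk]
      simpa using card_le_univ I
    rw [prod_const, prod_const, card_compl, hk, card_univ, Fintype.card_fin, Fintype.card_fin,
      ← Complex.exp_nat_mul, ← Complex.exp_nat_mul, ← Complex.exp_add] at h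
    have e : (N : ℂ) * -ρ + (M - k : ℕ) * ρ = (M - N - k) * ρ := by
      push_cast [hle]
      ring
    rw [e] at h
    rw [mul_comm (Complex.exp _)]
    exact h.const_mul _

theorem tendsto_subsetSum_left {N : ℕ} (k : ℕ) (x : Fin N → ℂ) (ρ : ℂ) (F : Fin N → ℂ) :
    Tendsto (fun w : ℝ => subsetSum k x ρ
      (fun m => Complex.sinh (x m - w + ρ) / Complex.sinh (x m - w) * F m))
      atTop (𝓝 (Complex.exp (-k * ρ) * subsetSum k x ρ F)) := by
  simp only [subsetSum, mul_sum]
  refine tendsto_finsetSum _ fun I hI => ?_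
  have h := tendsto_finsetProd I fun m _ => (tendsto_sinh_sub_add_div_sinh (x m) ρ).mul_const (F m)
  rw [prod_mul_distrib, prod_const, (mem_powersetCard.1 hI).2, ← Complex.exp_nat_mul] at h
  rw [mul_left_comm, neg_mul, ← mul_neg]
  exact h.const_mul _

/-- The kernel identity at the level of the coefficients. -/
theorem subsetSum_eq_sum {N l M : ℕ} (hM : M + l = N) {x : Fin N → ℂ} {v : Fin M → ℂ} {ρ : ℂ}
    (hx : ∀ i j, i ≠ j → Complex.sinh (x i - x j) ≠ 0)
    (hv : ∀ i j, i ≠ j → Complex.sinh (v i - v j) ≠ 0)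
    (h : ∀ i j, Complex.sinh (x i - v j) ≠ 0) (h' : ∀ i j, Complex.sinh (x i - v j + ρ) ≠ 0)
    (k : ℕ) :
    subsetSum k x ρ (fun m => ∏ n, Complex.sinh (x m - v n + ρ) / Complex.sinh (x m - v n)) =
      ∑ j ∈ range (k + 1), expESymm ρ l j * subsetSum (k - j) v (-ρ)
        (fun n => ∏ m, Complex.sinh (x m - v n + ρ) / Complex.sinh (x m - v n)) := by
  -- Raising `l` by one removes a `v` variable: the identity with `M + 1` variables is known, and
  -- the additional one, `w`, tends to `+∞`.
  induction l generalizing M k with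
  | zero =>
    obtain rfl : M = N := hM
    rw [sum_range_succ', sum_eq_zero fun j _ => by rw [expESymm_eq_zero ρ j.succ_pos, zero_mul],
      expESymm_zero_right, zero_add, one_mul, Nat.sub_zero]
    exact subsetSum_eq_subsetSum hx hv h h' k
  | succ l ih =>
    set f : Fin N → ℂ := fun m => ∏ n, Complex.sinh (x m - v n + ρ) / Complex.sinh (x m - v n)
    set F : Fin M → ℂ := fun n => ∏ m, Complex.sinh (x m - v n + ρ) / Complex.sinh (x m - v n)
      with hF
    -- The limit of the sum with `p` shifts. For `p = 0` the sum is identically `1`, and there is no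
    -- term in which `w` is shifted.
    set L : ℕ → ℂ := fun p => Nat.casesOn p 1 fun p =>
      Complex.exp (-(p + 1) * ρ) * subsetSum (p + 1) v (-ρ) F +
        Complex.exp ((M - N - p) * ρ) * subsetSum p v (-ρ) F with hL
    have hL0 : L 0 = 1 := rfl
    have hlim : ∀ p, Tendsto (fun w : ℝ => subsetSum p (Fin.cons (w : ℂ) v : Fin (M + 1) → ℂ) (-ρ)
        (Fin.cons (∏ m, Complex.sinh (x m - w + ρ) / Complex.sinh (x m - w)) F :
          Fin (M + 1) → ℂ)) atTop (𝓝 (L p)) := by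
      intro p
      cases p with
      | zero => simpa only [subsetSum_zero, hL0] using tendsto_const_nhds
      | succ p => exact tendsto_subsetSum_right p x v ρ F
    have hev : ∀ᶠ w : ℝ in atTop,
        subsetSum k x ρ (fun m => Complex.sinh (x m - w + ρ) / Complex.sinh (x m - w) * f m) =
        ∑ j ∈ range (k + 1), expESymm ρ l j *
          subsetSum (k - j) (Fin.cons (w : ℂ) v : Fin (M + 1) → ℂ) (-ρ)
            (Fin.cons (∏ m, Complex.sinh (x m - w + ρ) / Complex.sinh (x m - w)) F :
              Fin (M + 1) → ℂ) := by
      filter_upwards [eventually_all.2 fun m => eventually_sinh_sub_ne_zero (x m),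
        eventually_all.2 fun m => eventually_sinh_sub_ne_zero (x m + ρ),
        eventually_all.2 fun n => eventually_sinh_sub_ne_zero (v n)] with w h1 h2 h3
      have h2' : ∀ m, Complex.sinh (x m - w + ρ) ≠ 0 := fun m => by
        rw [sub_add_eq_add_sub]
        exact h2 m
      have key := ih (M := M + 1) (by omega) (v := (Fin.cons (w : ℂ) v : Fin (M + 1) → ℂ))
        (fun i j => by
          refine Fin.cases (Fin.cases ?_ fun j => ?_) (fun i => Fin.cases ?_ fun j => ?_) i j
          · exact fun h => absurd rfl h
          · intro _
            rw [Fin.cons_zero, Fin.cons_succ, ← neg_sub, Complex.sinh_neg]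
            exact neg_ne_zero.2 (h3 j)
          · exact fun _ => h3 i
          · exact fun hij => hv i j fun e => hij (congrArg _ e))
        (fun i j => Fin.cases (h1 i) (fun j => h i j) j)
        (fun i j => Fin.cases (h2' i) (fun j => h' i j) j) k
      simp only [Fin.prod_univ_succ, Fin.cons_zero, Fin.cons_succ] at key
      rw [key]
      refine sum_congr rfl fun j _ => ?_
      congr 2
      ext n
      refine Fin.cases ?_ (fun n => ?_) n <;> simp [hF]
    have hT := tendsto_nhds_unique ((tendsto_subsetSum_left k x ρ f).congr' hev)
      (tendsto_finsetSum _ fun j _ => (hlim (k - j)).const_mul _)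
    have hexp : Complex.exp (k * ρ) * Complex.exp (-k * ρ) = 1 := by
      rw [← Complex.exp_add]
      simp
    have hMN : (M : ℂ) - N = -(l + 1) := by
      rw [← hM]
      push_cast
      ring
    -- The left side converges to `exp (-k ρ)` times the wanted sum; multiplication by `exp (k ρ)`
    -- removes this factor.
    have hT' : subsetSum k x ρ f = ∑ j ∈ range (k + 1),
        expESymm ρ l j * (Complex.exp (k * ρ) * L (k - j)) := by
      simp only [mul_left_comm (expESymm ρ l _), ← mul_sum]
      rw [← hT, ← mul_assoc, hexp, one_mul]
    rw [hT', sum_range_succ, sum_range_succ' (fun j => expESymm ρ (l + 1) j * _)]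
    have hterm : ∀ j ∈ range k, expESymm ρ l j * (Complex.exp (k * ρ) * L (k - j)) =
        expESymm ρ l j * Complex.exp (j * ρ) * subsetSum (k - j) v (-ρ) F +
        expESymm ρ l j * Complex.exp ((j - l) * ρ) * subsetSum (k - (j + 1)) v (-ρ) F := by
      intro j hj
      obtain ⟨p, rfl⟩ : ∃ p, k = j + p + 1 := ⟨k - j - 1, by have := mem_range.1 hj; omega⟩
      have e1 : j + p + 1 - j = p + 1 := by omega
      have e2 : j + p + 1 - (j + 1) = p := by omega
      rw [e1, e2]
      simp only [hL, hMN]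
      rw [mul_add, ← mul_assoc, ← mul_assoc, ← Complex.exp_add, ← Complex.exp_add, mul_add,
        ← mul_assoc, ← mul_assoc]
      congr 4
      · push_cast
        ring
      · push_cast
        ring
    rw [sum_congr rfl hterm, sum_add_distrib]
    simp only [expESymm_succ_succ, add_mul, sum_add_distrib, expESymm_zero_right, one_mul,
      Nat.sub_zero]
    -- The terms without a shift of `w` are summed from `j = 0` on the one side and from `j + 1` in
    -- the recursion; the end terms `j = k` and `j = 0` make up the difference.
    have hshift : ∑ j ∈ range k, expESymm ρ l j * Complex.exp (j * ρ) *
        subsetSum (k - j) v (-ρ) F + expESymm ρ l k * (Complex.exp (k * ρ) * L (k - k)) =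
        ∑ j ∈ range k, expESymm ρ l (j + 1) * Complex.exp ((j + 1 : ℕ) * ρ) *
          subsetSum (k - (j + 1)) v (-ρ) F + subsetSum k v (-ρ) F := by
      have e := (sum_range_succ (fun j => expESymm ρ l j * Complex.exp (j * ρ) *
        subsetSum (k - j) v (-ρ) F) k).symm.trans (sum_range_succ' _ k)
      simp only [Nat.sub_self, subsetSum_zero, expESymm_zero_right, Nat.cast_zero, zero_mul,
        Complex.exp_zero, one_mul, Nat.sub_zero, mul_one] at e
      rw [← e, Nat.sub_self, hL0, mul_one]
    push_cast at hshift
    simp only [mul_comm (Complex.exp _) (expESymm _ _ _), add_mul, one_mul] at hshift ⊢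
    linear_combination hshift

end HyperbolicRCM

end

/-! ### The difference operators acting on the kernel function. -/

noncomputable section

open Finset Filter Topology

namespace HyperbolicRCM

variable {ap am : ℝ}

theorem scale_pos (hap : 0 < ap) (ham : 0 < am) (δ : ℤˣ) : 0 < scale ap am δ := by
  unfold scale
  split_ifs
  · exact hap
  · exact ham

/-- The difference equation with step `i a_{-δ}`. -/
theorem G_add_I_mul_scale (hap : 0 < ap) (ham : 0 < am) (δ : ℤˣ) {z : ℂ} (hz : z.re ≠ 0) :
    G ap am (z + Complex.I * scale ap am (-δ)) =
      2 * Complex.cosh (Real.pi * (z + Complex.I * scale ap am (-δ) / 2) / scale ap am δ) *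
        G ap am z := by
  have hne : (-1 : ℤˣ) ≠ 1 := by decide
  rcases Int.units_eq_one_or δ with rfl | rfl
  · rw [scale, if_neg hne, scale, if_pos rfl]
    exact G_add_I_mul_right hap ham hz
  · rw [neg_neg, scale, if_pos rfl, scale, if_neg hne]
    exact G_add_I_mul_left hap (cosh_add_half_ne_zero hz ap ham)

/-- The building block of the kernel function. -/
def kernelFactor (ap am : ℝ) (ρ z : ℂ) : ℂ := G ap am (z - ρ / 2) / G ap am (z + ρ / 2)

theorem S_eq (ρ : ℂ) {N M : ℕ} (x : Fin N → ℂ) (y : Fin M → ℂ) :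
    S ap am ρ x y = ∏ m, ∏ n, kernelFactor ap am ρ (x m - y n) := rfl

theorem sinh_add_pi_div_two_mul_I (u : ℂ) :
    Complex.sinh (u + Real.pi / 2 * Complex.I) = Complex.cosh u * Complex.I := by
  rw [Complex.sinh_add, Complex.cosh_mul_I, Complex.sinh_mul_I, Complex.cos_pi_div_two,
    Complex.sin_pi_div_two]
  ring

theorem int_units_mul_re (τ : ℤˣ) (a : ℝ) (z : ℂ) :
    (z - ((τ : ℤ) : ℂ) * (Complex.I * a) / 2).re = z.re := by
  rcases Int.units_eq_one_or τ with rfl | rfl <;> simp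

theorem re_add_units_mul_ne_zero {ρ z : ℂ} (h₁ : (z - ρ / 2).re ≠ 0) (h₂ : (z + ρ / 2).re ≠ 0)
    (τ : ℤˣ) : (z + ((τ : ℤ) : ℂ) * ρ / 2).re ≠ 0 ∧ (z - ((τ : ℤ) : ℂ) * ρ / 2).re ≠ 0 := by
  rcases Int.units_eq_one_or τ with rfl | rfl
  · rw [Units.val_one, Int.cast_one, one_mul]
    exact ⟨h₂, h₁⟩
  · rw [Units.val_neg, Units.val_one, Int.cast_neg, Int.cast_one, neg_one_mul, neg_div,
      ← sub_eq_add_neg, sub_neg_eq_add]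
    exact ⟨h₁, h₂⟩

/-- The effect of a shift on a building block of the kernel function. -/
theorem kernelFactor_shift (hap : 0 < ap) (ham : 0 < am) (δ τ : ℤˣ) {ρ z : ℂ}
    (h₁ : (z - ρ / 2).re ≠ 0) (h₂ : (z + ρ / 2).re ≠ 0) :
    kernelFactor ap am ρ (z - ((τ : ℤ) : ℂ) * (Complex.I * scale ap am (-δ))) =
      kernelFactor ap am ρ z *
        (Complex.cosh (Real.pi * (z - ((τ : ℤ) : ℂ) * (Complex.I * scale ap am (-δ)) / 2 +
            ((τ : ℤ) : ℂ) * ρ / 2) / scale ap am δ) /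
          Complex.cosh (Real.pi * (z - ((τ : ℤ) : ℂ) * (Complex.I * scale ap am (-δ)) / 2 -
            ((τ : ℤ) : ℂ) * ρ / 2) / scale ap am δ)) := by
  have ha := scale_pos hap ham δ
  set a := scale ap am δ
  set b := scale ap am (-δ) with hb
  have hG : ∀ w : ℂ, w.re ≠ 0 → G ap am (w + Complex.I * b) =
      2 * Complex.cosh (Real.pi * (w + Complex.I * b / 2) / a) * G ap am w :=
    fun w hw => G_add_I_mul_scale hap ham δ hw
  have hre : ∀ w : ℂ, w.re ≠ 0 → (w - Complex.I * b).re ≠ 0 := fun w hw => by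
    rwa [Complex.sub_re, I_mul_re, sub_zero]
  have hcosh : ∀ w : ℂ, w.re ≠ 0 →
      Complex.cosh (Real.pi * (w + Complex.I * b / 2) / a) ≠ 0 := fun w hw =>
    cosh_add_half_ne_zero hw b ha
  rcases Int.units_eq_one_or τ with rfl | rfl
  · have e₁ := hG _ (hre _ h₁)
    have e₂ := hG _ (hre _ h₂)
    have c₁ := hcosh _ (hre _ h₁)
    have c₂ := hcosh _ (hre _ h₂)
    rw [sub_add_cancel] at e₁ e₂
    simp only [kernelFactor, Units.val_one, Int.cast_one, one_mul]
    rw [e₁, e₂]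
    rw [show z - Complex.I * b - ρ / 2 = z - ρ / 2 - Complex.I * b by ring,
      show z - Complex.I * b + ρ / 2 = z + ρ / 2 - Complex.I * b by ring,
      show z - Complex.I * b / 2 + ρ / 2 = z + ρ / 2 - Complex.I * b + Complex.I * b / 2 by ring,
      show z - Complex.I * b / 2 - ρ / 2 = z - ρ / 2 - Complex.I * b + Complex.I * b / 2 by ring]
    have aux : ∀ p q u v : ℂ, p ≠ 0 → q ≠ 0 → u / v = 2 * p * u / (2 * q * v) * (q / p) := by
      intro p q u v hp hq
      field_simp
    exact aux _ _ _ _ c₁ c₂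
  · have e₁ := hG _ h₁
    have e₂ := hG _ h₂
    have c₁ := hcosh _ h₁
    have c₂ := hcosh _ h₂
    have n₂ := G_ne_zero_of_re_ne_zero ham h₂ (ap := ap)
    simp only [kernelFactor, Units.val_neg, Units.val_one, Int.cast_neg, Int.cast_one, neg_mul,
      one_mul, sub_neg_eq_add, neg_div]
    rw [show z + Complex.I * b - ρ / 2 = z - ρ / 2 + Complex.I * b by ring,
      show z + Complex.I * b + ρ / 2 = z + ρ / 2 + Complex.I * b by ring,
      show z + Complex.I * b / 2 + -(ρ / 2) = z - ρ / 2 + Complex.I * b / 2 by ring,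
      show z + Complex.I * b / 2 + ρ / 2 = z + ρ / 2 + Complex.I * b / 2 by ring, e₁, e₂]
    field_simp

/-- The reflection `i ↦ l - 1 - i` permutes the numbers. Hence the coefficients do not depend on
`τ`, which enters through `τ ρ`. -/
theorem expESymm_neg (ρ : ℂ) (l j : ℕ) : expESymm (-ρ) l j = expESymm ρ l j := by
  have h : (Multiset.range l).map (fun i => l - 1 - i) = Multiset.range l := by
    have h1 := congrArg Finset.val (Finset.range_image_pred_top_sub l)
    rwa [Finset.image_val_of_injOn, Finset.range_val] at h1
    intro i hi i' hi' hii
    simp only [Finset.coe_range, Set.mem_Iio] at hi hi' hii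
    omega
  rw [expESymm, expESymm, ← h, Multiset.map_map, h]
  congr 1
  refine Multiset.map_congr rfl fun i hi => ?_
  obtain ⟨p, rfl⟩ : ∃ p, l = i + p + 1 := ⟨l - i - 1, by have := Multiset.mem_range.1 hi; omega⟩
  have e : i + p + 1 - 1 - i = p := by omega
  simp only [Function.comp, e]
  congr 1
  push_cast
  ring

theorem expESymm_one_right_mul_sinh (ρ : ℂ) (l : ℕ) :
    expESymm ρ l 1 * Complex.sinh ρ = Complex.sinh (l * ρ) := by
  induction l with
  | zero => simp [expESymm_eq_zero]
  | succ l ih =>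
    rw [expESymm_succ_succ ρ l 0, expESymm_zero_right, Nat.cast_zero, zero_add, one_mul, mul_one,
      zero_sub, add_mul, mul_assoc, ih]
    push_cast
    rw [add_mul, one_mul, Complex.sinh_add, ← Complex.cosh_add_sinh, neg_mul,
      ← Complex.cosh_sub_sinh]
    ring

theorem c_eq_expESymm (ρ : ℂ) (δ : ℤˣ) (l j : ℕ) :
    c ap am ρ δ l j = expESymm (Real.pi * ρ / scale ap am δ) l j := by
  rw [c, expESymm]
  congr 1
  refine Multiset.map_congr rfl fun i _ => ?_
  rw [e]
  congr 1
  ring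

theorem expESymm_units_mul (ρ : ℂ) (δ τ : ℤˣ) (l j : ℕ) :
    expESymm (Real.pi * (((τ : ℤ) : ℂ) * ρ) / scale ap am δ) l j = c ap am ρ δ l j := by
  rw [c_eq_expESymm]
  rcases Int.units_eq_one_or τ with rfl | rfl
  · simp
  · rw [← expESymm_neg]
    congr 1
    push_cast
    ring

theorem s_sub_eq (δ : ℤˣ) (u v ρ : ℂ) :
    s ap am δ (u - v - ρ) = Complex.sinh (Real.pi * u / scale ap am δ -
      Real.pi * v / scale ap am δ - Real.pi * ρ / scale ap am δ) := by
  rw [s]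
  congr 1
  ring

theorem s_sub_eq' (δ : ℤˣ) (u v : ℂ) :
    s ap am δ (u - v) = Complex.sinh (Real.pi * u / scale ap am δ -
      Real.pi * v / scale ap am δ) := by
  rw [s]
  congr 1
  ring

/-- The same ratio `r` serves here and in `S_shift_right`, because lowering `x m` by `C` and raising
`y n` by `C` change `x m - y n` alike. -/
theorem S_shift_left {N M : ℕ} {ρ C : ℂ} {x : Fin N → ℂ} {y : Fin M → ℂ} {r : Fin N → Fin M → ℂ}
    (hr : ∀ m n, kernelFactor ap am ρ (x m - y n - C) =
      kernelFactor ap am ρ (x m - y n) * r m n) (I : Finset (Fin N)) :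
    S ap am ρ (fun m => if m ∈ I then x m - C else x m) y =
      S ap am ρ x y * ∏ m ∈ I, ∏ n, r m n := by
  have h : ∏ m ∈ I, ∏ n, r m n = ∏ m, if m ∈ I then ∏ n, r m n else 1 := by
    rw [prod_ite_mem, univ_inter]
  rw [h, S_eq, S_eq, ← prod_mul_distrib]
  refine prod_congr rfl fun m _ => ?_
  by_cases hm : m ∈ I
  · simp only [hm, if_true]
    rw [← prod_mul_distrib]
    exact prod_congr rfl fun n _ => by rw [sub_right_comm, hr]
  · simp only [hm, if_false, mul_one]

theorem S_shift_right {N M : ℕ} {ρ C : ℂ} {x : Fin N → ℂ} {y : Fin M → ℂ} {r : Fin N → Fin M → ℂ}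
    (hr : ∀ m n, kernelFactor ap am ρ (x m - y n - C) =
      kernelFactor ap am ρ (x m - y n) * r m n) (I : Finset (Fin M)) :
    S ap am ρ x (fun n => if n ∈ I then y n + C else y n) =
      S ap am ρ x y * ∏ n ∈ I, ∏ m, r m n := by
  have h : ∏ n ∈ I, ∏ m, r m n = ∏ n, if n ∈ I then ∏ m, r m n else 1 := by
    rw [prod_ite_mem, univ_inter]
  rw [h, S_eq, S_eq, Finset.prod_comm, Finset.prod_comm (s := univ) (t := univ)
    (f := fun m n => kernelFactor ap am ρ (x m - y n)), ← prod_mul_distrib]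
  refine prod_congr rfl fun n _ => ?_
  by_cases hn : n ∈ I
  · simp only [hn, if_true]
    rw [← prod_mul_distrib]
    exact prod_congr rfl fun m _ => by rw [← sub_sub, hr]
  · simp only [hn, if_false, mul_one]

/-- The kernel identity at points where no zero or pole of `G` can occur. -/
theorem kernel_identity_generic (hap : 0 < ap) (ham : 0 < am) (ρ : ℂ) (δ τ : ℤˣ) {N M l : ℕ}
    (hM : M + l = N) (k : ℕ) {x : Fin N → ℂ} {y : Fin M → ℂ} (hx : RegularPoint ap am δ x)
    (hy : RegularPoint ap am δ y) (h₁ : ∀ m n, (x m - y n - ρ / 2).re ≠ 0)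
    (h₂ : ∀ m n, (x m - y n + ρ / 2).re ≠ 0) :
    A ap am ρ δ τ k (fun x' => S ap am ρ x' y) x =
      ∑ j ∈ range (k + 1), c ap am ρ δ l j *
        A ap am ρ δ (-τ) (k - j) (fun y' => S ap am ρ x y') y := by
  have ha := scale_pos hap ham δ
  set a := scale ap am δ with hadef
  set C : ℂ := ((τ : ℤ) : ℂ) * (Complex.I * scale ap am (-δ)) with hC
  set P : ℂ := Real.pi * (((τ : ℤ) : ℂ) * ρ) / a with hP
  set X : Fin N → ℂ := fun m => Real.pi * x m / a with hX
  -- The translation by `C / 2 + τ ρ / 2` centres the arguments of the two `cosh`, and the quarter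
  -- period turns them into `sinh`. Differences of the `V n`, hence the coefficients of the operator
  -- in `y`, are unaffected.
  set V : Fin M → ℂ := fun n =>
    Real.pi * (y n + C / 2 + ((τ : ℤ) : ℂ) * ρ / 2) / a - Real.pi / 2 * Complex.I with hV
  have e₁ : ∀ m n, Complex.sinh (X m - V n) = Complex.cosh
      (Real.pi * (x m - y n - C / 2 - ((τ : ℤ) : ℂ) * ρ / 2) / a) * Complex.I := fun m n => by
    rw [← sinh_add_pi_div_two_mul_I]
    congr 1
    simp only [hX, hV]
    ring
  have e₂ : ∀ m n, Complex.sinh (X m - V n + P) = Complex.cosh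
      (Real.pi * (x m - y n - C / 2 + ((τ : ℤ) : ℂ) * ρ / 2) / a) * Complex.I := fun m n => by
    rw [← sinh_add_pi_div_two_mul_I]
    congr 1
    simp only [hX, hV, hP]
    ring
  have hr : ∀ m n, kernelFactor ap am ρ (x m - y n - C) = kernelFactor ap am ρ (x m - y n) *
      (Complex.sinh (X m - V n + P) / Complex.sinh (X m - V n)) := fun m n => by
    rw [e₁, e₂, mul_div_mul_right _ _ Complex.I_ne_zero]
    exact kernelFactor_shift hap ham δ τ (h₁ m n) (h₂ m n)
  have hre : ∀ m n, (x m - y n - C / 2 + ((τ : ℤ) : ℂ) * ρ / 2).re ≠ 0 ∧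
      (x m - y n - C / 2 - ((τ : ℤ) : ℂ) * ρ / 2).re ≠ 0 := fun m n => by
    have := int_units_mul_re τ (scale ap am (-δ)) (x m - y n)
    refine re_add_units_mul_ne_zero ?_ ?_ τ
    · rw [Complex.sub_re, hC, this, ← Complex.sub_re]
      exact h₁ m n
    · rw [Complex.add_re, hC, this, ← Complex.add_re]
      exact h₂ m n
  have hAx : A ap am ρ δ τ k (fun x' => S ap am ρ x' y) x = S ap am ρ x y *
      subsetSum k X P
        (fun m => ∏ n, Complex.sinh (X m - V n + P) / Complex.sinh (X m - V n)) := by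
    rw [A, subsetSum, mul_sum]
    refine sum_congr rfl fun I _ => ?_
    rw [S_shift_left hr I, mul_left_comm]
    simp only [s_sub_eq]
    simp only [s_sub_eq', hX, hP, hadef]
  have hVV : ∀ m n, V m - V n = Real.pi * y m / a - Real.pi * y n / a := fun m n => by
    simp only [hV]
    ring
  have hAy : ∀ p, A ap am ρ δ (-τ) p (fun y' => S ap am ρ x y') y = S ap am ρ x y *
      subsetSum p V (-P)
        (fun n => ∏ m, Complex.sinh (X m - V n + P) / Complex.sinh (X m - V n)) := by
    intro p
    rw [A, subsetSum, mul_sum]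
    refine sum_congr rfl fun I _ => ?_
    have hs : (fun n => if n ∈ I then
        y n - (((-τ : ℤˣ) : ℤ) : ℂ) * (Complex.I * scale ap am (-δ)) else y n) =
        fun n => if n ∈ I then y n + C else y n := by
      funext n
      rw [hC]
      push_cast
      rw [neg_mul, sub_neg_eq_add]
    have hP' : Real.pi * ((((-τ : ℤˣ) : ℤ) : ℂ) * ρ) / a = -P := by
      rw [hP]
      push_cast
      ring
    rw [hs, S_shift_right hr I, mul_left_comm]
    simp only [s_sub_eq]
    simp only [s_sub_eq', ← hadef, hVV, hP']
  have hid := subsetSum_eq_sum (x := X) (v := V) (ρ := P) hM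
    (fun i j hij => by
      have := hx i j hij
      rwa [s_sub_eq'] at this)
    (fun i j hij => by
      have := hy i j hij
      rwa [s_sub_eq', ← hadef, ← hVV] at this)
    (fun i j => by
      rw [e₁]
      exact mul_ne_zero (cosh_pi_mul_div_ne_zero (hre i j).2 ha) Complex.I_ne_zero)
    (fun i j => by
      rw [e₂]
      exact mul_ne_zero (cosh_pi_mul_div_ne_zero (hre i j).1 ha) Complex.I_ne_zero) k
  rw [hAx, hid, mul_sum]
  refine sum_congr rfl fun j _ => ?_
  rw [hAy, hP, hadef, expESymm_units_mul, mul_left_comm]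

theorem continuousAt_kernelFactor (hap : 0 < ap) (ham : 0 < am) {ρ z : ℂ}
    (h₁ : z - ρ / 2 ∉ poleSet ap am) (h₂ : z + ρ / 2 ∉ zeroSet ap am) :
    ContinuousAt (fun t : ℝ => kernelFactor ap am ρ (z + t)) 0 := by
  have h := (continuousAt_G_add_ofReal hap ham h₁).mul (continuousAt_inv_G_add_ofReal hap ham h₂)
  refine h.congr (Eventually.of_forall fun t => ?_)
  change G ap am (z - ρ / 2 + t) * (G ap am (z + ρ / 2 + t))⁻¹ =
    G ap am (z + t - ρ / 2) / G ap am (z + t + ρ / 2)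
  rw [sub_add_eq_add_sub, add_right_comm z, div_eq_mul_inv (G ap am _)]

theorem continuousAt_S (hap : 0 < ap) (ham : 0 < am) {ρ : ℂ} {N M : ℕ} {x : Fin N → ℂ}
    {y : Fin M → ℂ} (h₁ : ∀ m n, x m - y n - ρ / 2 ∉ poleSet ap am)
    (h₂ : ∀ m n, x m - y n + ρ / 2 ∉ zeroSet ap am) :
    ContinuousAt (fun t : ℝ => S ap am ρ (fun m => x m + t) y) 0 := by
  simp only [S_eq]
  refine tendsto_finsetProd _ fun m _ => tendsto_finsetProd _ fun n _ => ?_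
  simp only [add_sub_right_comm]
  exact continuousAt_kernelFactor hap ham (h₁ m n) (h₂ m n)

/-- A common translation of all `x m` leaves the coefficients constant, so only the kernel function
varies with `t`. -/
theorem continuousAt_A_left (hap : 0 < ap) (ham : 0 < am) {ρ : ℂ} {δ τ : ℤˣ} {N M : ℕ}
    {x : Fin N → ℂ} {y : Fin M → ℂ} (h : RegularKernel ap am ρ δ τ x y) (k : ℕ) :
    ContinuousAt (fun t : ℝ => A ap am ρ δ τ k (fun x' => S ap am ρ x' y) (fun m => x m + t))
      0 := by
  simp only [A, add_sub_add_right_eq_sub]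
  refine tendsto_finsetSum _ fun I _ => Tendsto.const_mul _ ?_
  have hS := continuousAt_S hap ham (ρ := ρ) (y := y)
    (x := fun m => if m ∈ I then x m - ((τ : ℤ) : ℂ) * (Complex.I * scale ap am (-δ)) else x m)
    (fun m n => by
      by_cases hm : m ∈ I
      · simp only [hm, if_true]
        exact (h m n _ (Or.inr (sub_right_comm _ _ _))).1
      · simp only [hm, if_false]
        exact (h m n _ (Or.inl rfl)).1)
    (fun m n => by
      by_cases hm : m ∈ I
      · simp only [hm, if_true]
        exact (h m n _ (Or.inr (sub_right_comm _ _ _))).2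
      · simp only [hm, if_false]
        exact (h m n _ (Or.inl rfl)).2)
  have e : ∀ t : ℝ, (fun m => if m ∈ I then
      x m + t - ((τ : ℤ) : ℂ) * (Complex.I * scale ap am (-δ)) else x m + t) =
      fun m => (if m ∈ I then x m - ((τ : ℤ) : ℂ) * (Complex.I * scale ap am (-δ)) else x m) + t :=
    fun t => by
      funext m
      split_ifs
      · rw [add_sub_right_comm]
      · rfl
  simp only [e]
  exact hS

theorem continuousAt_A_right (hap : 0 < ap) (ham : 0 < am) {ρ : ℂ} {δ τ : ℤˣ} {N M : ℕ}
    {x : Fin N → ℂ} {y : Fin M → ℂ} (h : RegularKernel ap am ρ δ τ x y) (k : ℕ) :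
    ContinuousAt (fun t : ℝ => A ap am ρ δ (-τ) k (fun y' => S ap am ρ (fun m => x m + t) y') y)
      0 := by
  simp only [A]
  refine tendsto_finsetSum _ fun I _ => Tendsto.const_mul _ ?_
  have e : ∀ m n, x m - (y n - (((-τ : ℤˣ) : ℤ) : ℂ) * (Complex.I * scale ap am (-δ))) =
      x m - y n - ((τ : ℤ) : ℂ) * (Complex.I * scale ap am (-δ)) := fun m n => by
    push_cast
    ring
  refine continuousAt_S hap ham (fun m n => ?_) (fun m n => ?_)
  · by_cases hn : n ∈ I
    · simp only [hn, if_true]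
      exact (h m n _ (Or.inr (e m n))).1
    · simp only [hn, if_false]
      exact (h m n _ (Or.inl rfl)).1
  · by_cases hn : n ∈ I
    · simp only [hn, if_true]
      exact (h m n _ (Or.inr (e m n))).2
    · simp only [hn, if_false]
      exact (h m n _ (Or.inl rfl)).2

theorem eventually_add_ne_zero (r : ℝ) : ∀ᶠ t in 𝓝[≠] (0 : ℝ), r + t ≠ 0 := by
  rcases eq_or_ne r 0 with rfl | hr
  · filter_upwards [self_mem_nhdsWithin] with t ht
    simpa using ht
  · refine Filter.Eventually.filter_mono nhdsWithin_le_nhds ?_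
    exact (continuous_const.add continuous_id).continuousAt.eventually_ne (by simpa using hr)

/-- The kernel identity at all regular points. -/
theorem kernel_identity (hap : 0 < ap) (ham : 0 < am) (ρ : ℂ) (δ τ : ℤˣ) {N M l : ℕ}
    (hM : M + l = N) (k : ℕ) {x : Fin N → ℂ} {y : Fin M → ℂ} (hx : RegularPoint ap am δ x)
    (hy : RegularPoint ap am δ y) (h : RegularKernel ap am ρ δ τ x y) :
    A ap am ρ δ τ k (fun x' => S ap am ρ x' y) x =
      ∑ j ∈ range (k + 1), c ap am ρ δ l j *
        A ap am ρ δ (-τ) (k - j) (fun y' => S ap am ρ x y') y := by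
  have hL := (continuousAt_A_left hap ham h k).tendsto.mono_left
    (nhdsWithin_le_nhds (s := {(0 : ℝ)}ᶜ))
  have hR := (tendsto_finsetSum (range (k + 1)) fun j _ =>
    (continuousAt_A_right hap ham h (k - j)).tendsto.const_mul (c ap am ρ δ l j)).mono_left
      (nhdsWithin_le_nhds (s := {(0 : ℝ)}ᶜ))
  -- For small `t ≠ 0` the translated point satisfies all the finitely many conditions on real
  -- parts; both sides are continuous at `t = 0`.
  have hev : ∀ᶠ t : ℝ in 𝓝[≠] 0,
      A ap am ρ δ τ k (fun x' => S ap am ρ x' y) (fun m => x m + t) =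
        ∑ j ∈ range (k + 1), c ap am ρ δ l j *
          A ap am ρ δ (-τ) (k - j) (fun y' => S ap am ρ (fun m => x m + t) y') y := by
    filter_upwards [eventually_all.2 fun m => eventually_all.2 fun n =>
        eventually_add_ne_zero (x m - y n - ρ / 2).re,
      eventually_all.2 fun m => eventually_all.2 fun n =>
        eventually_add_ne_zero (x m - y n + ρ / 2).re] with t h₁ h₂
    refine kernel_identity_generic hap ham ρ δ τ hM k (fun m n hmn => ?_) hy (fun m n => ?_)
      (fun m n => ?_)
    · rw [add_sub_add_right_eq_sub]
      exact hx m n hmn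
    · rw [show x m + t - y n - ρ / 2 = x m - y n - ρ / 2 + t by ring, Complex.add_re,
        Complex.ofReal_re]
      exact h₁ m n
    · rw [show x m + t - y n + ρ / 2 = x m - y n + ρ / 2 + t by ring, Complex.add_re,
        Complex.ofReal_re]
      exact h₂ m n
  simpa using tendsto_nhds_unique (hL.congr' hev) hR

theorem A_zero (ρ : ℂ) (δ τ : ℤˣ) {M : ℕ} (F : (Fin M → ℂ) → ℂ) (x : Fin M → ℂ) :
    A ap am ρ δ τ 0 F x = F x := by
  simp [A]

theorem A_eq_zero (ρ : ℂ) (δ τ : ℤˣ) {M k : ℕ} (h : M < k) (F : (Fin M → ℂ) → ℂ) (x : Fin M → ℂ) :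
    A ap am ρ δ τ k F x = 0 := by
  rw [A, powersetCard_eq_empty.2 (by simpa using h), sum_empty]

theorem c_zero_right (ρ : ℂ) (δ : ℤˣ) (l : ℕ) : c ap am ρ δ l 0 = 1 := by
  rw [c_eq_expESymm, expESymm_zero_right]

theorem c_one_one (ρ : ℂ) (δ : ℤˣ) : c ap am ρ δ 1 1 = 1 := by
  rw [c_eq_expESymm, expESymm_succ_succ _ 0 0, zero_add, expESymm_eq_zero _ one_pos, expESymm_zero_right]
  simp

theorem c_one_right (ρ : ℂ) (δ : ℤˣ) (l : ℕ) (h : s ap am δ ρ ≠ 0) :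
    c ap am ρ δ l 1 = s ap am δ (l * ρ) / s ap am δ ρ := by
  rw [eq_div_iff h, c_eq_expESymm, s, expESymm_one_right_mul_sinh, s]
  congr 1
  ring

/-- The kernel identity without kernel function. -/
theorem sum_prod_eq_c (hap : 0 < ap) (ham : 0 < am) (ρ : ℂ) (δ τ : ℤˣ) {N : ℕ} (k : ℕ)
    {x : Fin N → ℂ} (hx : RegularPoint ap am δ x) :
    ∑ I ∈ powersetCard k (univ : Finset (Fin N)), ∏ m ∈ I, ∏ n ∈ Iᶜ,
      s ap am δ (x m - x n - ((τ : ℤ) : ℂ) * ρ) / s ap am δ (x m - x n) = c ap am ρ δ N k := by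
  -- With no `y` variables the kernel function is `1`, and the operators on the right vanish except
  -- for `j = k`.
  have h := kernel_identity hap ham ρ δ τ (zero_add N) k (y := Fin.elim0) hx
    (fun m => m.elim0) (fun _ n => n.elim0)
  rw [sum_range_succ, sum_eq_zero, zero_add, Nat.sub_self, A_zero] at h
  · simpa [A, S] using h
  · intro j hj
    have := mem_range.1 hj
    rw [A_eq_zero _ _ _ (by omega), mul_zero]

end HyperbolicRCM

end

/-! ### The theorem and its special cases. -/

theorem theorem2p1 (ap am : ℝ) (hap : 0 < ap) (ham : 0 < am) (ρ : ℂ) (δ τ : ℤˣ) (N : ℕ) :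
    -- the kernel identities, for all `ℓ` and `k`
    (∀ l : ℕ, l ≤ N → ∀ k : ℕ, 1 ≤ k → k ≤ N →
      ∀ (x : Fin N → ℂ) (y : Fin (N - l) → ℂ),
        HyperbolicRCM.RegularPoint ap am δ x → HyperbolicRCM.RegularPoint ap am δ y →
        HyperbolicRCM.RegularKernel ap am ρ δ τ x y →
        HyperbolicRCM.A ap am ρ δ τ k (fun x' => HyperbolicRCM.S ap am ρ x' y) x =
          ∑ j ∈ Finset.range (min k l + 1), HyperbolicRCM.c ap am ρ δ l j *
            HyperbolicRCM.A ap am ρ δ (-τ) (k - j) (fun y' => HyperbolicRCM.S ap am ρ x y') y) ∧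
    -- the special case `k = 1`
    (HyperbolicRCM.s ap am δ ρ ≠ 0 → ∀ l : ℕ, l ≤ N →
      ∀ (x : Fin N → ℂ) (y : Fin (N - l) → ℂ),
        HyperbolicRCM.RegularPoint ap am δ x → HyperbolicRCM.RegularPoint ap am δ y →
        HyperbolicRCM.RegularKernel ap am ρ δ τ x y →
        HyperbolicRCM.A ap am ρ δ τ 1 (fun x' => HyperbolicRCM.S ap am ρ x' y) x -
            HyperbolicRCM.A ap am ρ δ (-τ) 1 (fun y' => HyperbolicRCM.S ap am ρ x y') y =
          HyperbolicRCM.s ap am δ (l * ρ) / HyperbolicRCM.s ap am δ ρ *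
            HyperbolicRCM.S ap am ρ x y) ∧
    -- the special case `ℓ = 1`
    (∀ k : ℕ, 1 ≤ k → k ≤ N →
      ∀ (x : Fin N → ℂ) (y : Fin (N - 1) → ℂ),
        HyperbolicRCM.RegularPoint ap am δ x → HyperbolicRCM.RegularPoint ap am δ y →
        HyperbolicRCM.RegularKernel ap am ρ δ τ x y →
        HyperbolicRCM.A ap am ρ δ τ k (fun x' => HyperbolicRCM.S ap am ρ x' y) x =
          HyperbolicRCM.A ap am ρ δ (-τ) k (fun y' => HyperbolicRCM.S ap am ρ x y') y +
            HyperbolicRCM.A ap am ρ δ (-τ) (k - 1) (fun y' => HyperbolicRCM.S ap am ρ x y') y) ∧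
    -- the special case `ℓ = N`
    (∀ k : ℕ, 1 ≤ k → k ≤ N → ∀ x : Fin N → ℂ, HyperbolicRCM.RegularPoint ap am δ x →
      ∑ I ∈ Finset.powersetCard k (Finset.univ : Finset (Fin N)), ∏ m ∈ I, ∏ n ∈ Iᶜ,
          HyperbolicRCM.s ap am δ (x m - x n - ((τ : ℤ) : ℂ) * ρ) /
            HyperbolicRCM.s ap am δ (x m - x n) =
        HyperbolicRCM.c ap am ρ δ N k) := by
  refine ⟨fun l hl k _ _ x y hx hy h => ?_, fun hs l hl x y hx hy h => ?_,
    fun k hk hkN x y hx hy h => ?_, fun k _ _ x hx => ?_⟩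
  · rw [HyperbolicRCM.kernel_identity hap ham ρ δ τ (Nat.sub_add_cancel hl) k hx hy h, eq_comm]
    -- The range `j ≤ k` may be cut at `min k l`, since there are no elementary symmetric functions
    -- of degree above `l`.
    refine Finset.sum_subset (fun j hj => ?_) fun j hj hj' => ?_
    · rw [Finset.mem_range] at hj ⊢
      omega
    · rw [Finset.mem_range] at hj hj'
      rw [HyperbolicRCM.c_eq_expESymm, HyperbolicRCM.expESymm_eq_zero _ (by omega), zero_mul]
  · rw [HyperbolicRCM.kernel_identity hap ham ρ δ τ (Nat.sub_add_cancel hl) 1 hx hy h,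
      Finset.sum_range_succ, Finset.sum_range_one, HyperbolicRCM.c_zero_right,
      HyperbolicRCM.c_one_right ρ δ l hs, Nat.sub_self, HyperbolicRCM.A_zero, Nat.sub_zero]
    ring
  · rw [HyperbolicRCM.kernel_identity hap ham ρ δ τ (Nat.sub_add_cancel (hk.trans hkN)) k hx hy h]
    obtain ⟨p, rfl⟩ : ∃ p, k = p + 1 := ⟨k - 1, by omega⟩
    -- For `l = 1` only `j = 0` and `j = 1` survive, both with coefficient `1`.
    rw [Finset.sum_range_succ', Finset.sum_range_succ', Finset.sum_eq_zero fun j _ => by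
      rw [HyperbolicRCM.c_eq_expESymm, HyperbolicRCM.expESymm_eq_zero _ (by omega), zero_mul]]
    rw [zero_add, zero_add, HyperbolicRCM.c_one_one, HyperbolicRCM.c_zero_right, one_mul, one_mul,
      Nat.sub_zero, add_comm]
  · exact HyperbolicRCM.sum_prod_eq_c hap ham ρ δ τ k hx
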